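/- A Prüfer domain is an integral domain whose localisation at every prime ideal is a valuation ring, and a Prüfer ring is a commutative ring that is isomorphic to a finite product of Prüfer domains. For a scheme $X$, an $\mathcal{O}_X$-module $\mathcal{F}$ is coherent if it is of finite type and if, for every open $U \subseteq X$ and every finite family of sections $s_1, \dots, s_n \in \mathcal{F}(U)$, the kernel of the associated morphism $\bigoplus_{i=1}^n \mathcal{O}_U \to \mathcal{F}|_U$ is of finite type. A scheme $X$ is locally coherent if $\mathcal{O}_X$ is a coherent $\mathcal{O}_X$-module, and it is coherent if it is moreover quasi-compact and quasi-separated. A commutative ring $A$ is coherent if the scheme $\operatorname{Spec}(A)$ is coherent. **Lemma 2.12.** Let $R$ be a Prüfer ring. 1. Every scheme $X$ that is locally of finite presentation over $\operatorname{Spec}(R)$ is locally coherent. 2. Every finitely presented commutative $R$-algebra $A$ is a coherent ring, and every finitely generated ideal of $A$ is finitely presented as an $A$-module. -/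

import Mathlib

open CategoryTheory CategoryTheory.Limits AlgebraicGeometry

universe u

/-- A Prüfer domain: an integral domain whose localisation at every prime ideal is a
valuation ring. -/
structure IsPruferDomain (R : Type u) [CommRing R] : Prop where
  isDomain : IsDomain R
  valuationRing_localization : ∀ (p : Ideal R) [p.IsPrime],
    ∃ _ : IsDomain (Localization.AtPrime p), ValuationRing (Localization.AtPrime p)

/-- A Prüfer ring: a commutative ring that is isomorphic to a finite product of Prüfer domains. -/
def IsPruferRing (R : Type u) [CommRing R] : Prop :=
  ∃ (n : ℕ) (D : Fin n → Type u) (_ : ∀ i, CommRing (D i)),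
    (∀ i, IsPruferDomain (D i)) ∧ Nonempty (R ≃+* (∀ i, D i))

/-- An `𝒪_X`-module `M` is coherent if it is of finite type and, for every open `U ⊆ X` and every
finite family `s` of sections of `M` over `U` (that is, of global sections of `M|_U`), the kernel
of the associated morphism `⨁ i, 𝒪_U ⟶ M|_U` is an `𝒪_U`-module of finite type. -/
structure AlgebraicGeometry.Scheme.Modules.IsCoherent {X : Scheme.{u}} (M : X.Modules) : Prop where
  isFiniteType : SheafOfModules.IsFiniteType.{u} (R := X.ringCatSheaf) M
  isFiniteType_kernel : ∀ (U : X.Opens) (I : Type u) [Finite I]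
    (s : I → SheafOfModules.sections (R := U.toScheme.ringCatSheaf) (M.restrict U.ι)),
    SheafOfModules.IsFiniteType.{u} (R := U.toScheme.ringCatSheaf)
      (kernel ((SheafOfModules.freeHomEquiv (R := U.toScheme.ringCatSheaf)
        (M.restrict U.ι)).symm s))

/-- A scheme `X` is locally coherent if `𝒪_X` is a coherent module over itself. -/
def AlgebraicGeometry.Scheme.IsLocallyCoherent (X : Scheme.{u}) : Prop :=
  Scheme.Modules.IsCoherent (X := X) (SheafOfModules.unit X.ringCatSheaf)

/-- A scheme is coherent if it is locally coherent, quasi-compact and quasi-separated. -/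
structure AlgebraicGeometry.Scheme.IsCoherent (X : Scheme.{u}) : Prop where
  isLocallyCoherent : X.IsLocallyCoherent
  compactSpace : CompactSpace X
  quasiSeparatedSpace : QuasiSeparatedSpace X

/-- A commutative ring is coherent if its spectrum is a coherent scheme. -/
def IsCoherentRing (A : Type u) [CommRing A] : Prop :=
  (Spec (CommRingCat.of A)).IsCoherent

/-! Everything rests on linear syzygies. If each finite family in `A` has a finitely generated
module of relations (`HasFGSyzygies`), then finitely generated ideals are finitely presented; and
since basic opens of an affine open are localisations, the same property on affine opens makes the
structure sheaf coherent. Quotients by finitely generated ideals and finite products reduce the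
property to polynomial rings over a Prüfer domain `R`.

There the syzygies are packaged into the kernel of an algebra map between square-zero extensions,
and homogenising turns that kernel into a homogeneous ideal `I` of a polynomial ring whose quotient
is torsion-free over `R`. The heart of the proof is that such an `I` is finitely generated
(`fg_of_homogeneous_of_saturated`).

Fix a prime `p` and a finitely generated homogeneous `I' ≤ I` with the same image over the residue
field of `p`. Generic freeness and Noetherian induction over a finitely generated ring of
coefficients show that finitely many sets of monomials serve as complements of `I'` over all fields
(`exists_finite_isCompl`). So the quotients by `I'` have only finitely many Hilbert functions, told
apart in degrees up to some `D`. As the localisation at `p` is a valuation ring and `I` is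
saturated, monomials independent modulo `I` over the residue field remain so over `R`; hence the
Hilbert function at `p` is at most the generic one. Nakayama in degrees up to `D` gives a
neighbourhood of `p` where the Hilbert function is the generic one up to `D`, hence in all degrees.
This forces `I'` and `I` to agree locally there, and compactness of the spectrum concludes. -/

namespace MvPolynomial

/-! ### Monomial complements of ideals under base change -/

section Complement

variable {σ A k : Type*} [CommRing A] [CommRing k]

theorem restrictScalars_map_eq_span (ψ : A →+* k) (J : Ideal (MvPolynomial σ A)) :
    (J.map (map ψ)).restrictScalars k =
      Submodule.span k (map ψ '' (J : Set (MvPolynomial σ A))) := by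
  apply le_antisymm
  · intro z hz
    rw [Submodule.restrictScalars_mem] at hz
    refine Submodule.span_induction (p := fun z _ => z ∈ Submodule.span k
      (map ψ '' (J : Set (MvPolynomial σ A)))) (fun x hx => Submodule.subset_span hx)
      (Submodule.zero_mem _) (fun x y _ _ hx hy => add_mem hx hy) ?_ hz
    intro p x _ hx
    rw [smul_eq_mul]
    refine Submodule.span_induction (p := fun x _ => p * x ∈ Submodule.span k
      (map ψ '' (J : Set (MvPolynomial σ A)))) ?_ (by simp)
      (fun x y _ _ hx hy => by rw [mul_add]; exact add_mem hx hy)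
      (fun c x _ hx => by rw [mul_smul_comm]; exact Submodule.smul_mem _ _ hx) hx
    rintro _ ⟨h, hh, rfl⟩
    induction p using MvPolynomial.induction_on'' with
    | C a => rw [C_mul']; exact Submodule.smul_mem _ _ (Submodule.subset_span ⟨h, hh, rfl⟩)
    | monomial_add a b f _ _ h1 h2 => rw [add_mul]; exact add_mem h2 h1
    | mul_X p n hp =>
      have : ∀ q : MvPolynomial σ k, q ∈ Submodule.span k (map ψ '' (J : Set (MvPolynomial σ A))) →
          X n * q ∈ Submodule.span k (map ψ '' (J : Set (MvPolynomial σ A))) := by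
        intro q hq
        refine Submodule.span_induction (p := fun x _ => X n * x ∈ Submodule.span k
          (map ψ '' (J : Set (MvPolynomial σ A)))) ?_ (by simp)
          (fun x y _ _ hx hy => by rw [mul_add]; exact add_mem hx hy)
          (fun c x _ hx => by rw [mul_smul_comm]; exact Submodule.smul_mem _ _ hx) hq
        rintro _ ⟨h, hh, rfl⟩
        exact Submodule.subset_span ⟨X n * h, J.mul_mem_left _ hh, by simp⟩
      rw [mul_comm p, mul_assoc]
      exact this _ hp
  · rw [Submodule.span_le]
    rintro _ ⟨h, hh, rfl⟩
    exact Ideal.mem_map_of_mem _ hh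

theorem isCompl_restrictSupport_map (ψ : A →+* k) (J : Ideal (MvPolynomial σ A))
    {B : Set (σ →₀ ℕ)} (H : IsCompl (J.restrictScalars A) (restrictSupport A B)) :
    IsCompl ((J.map (map ψ)).restrictScalars k) (restrictSupport k B) := by
  let pr := (restrictSupport A B).subtype ∘ₗ Submodule.projectionOnto _ _ H.symm
  -- `N` is the base change of the projection `pr` along `J`: it kills the extended ideal and fixes
  -- the span of `B`, whence disjointness.
  let N : MvPolynomial σ k →ₗ[k] MvPolynomial σ k :=
    (basisMonomials σ k).constr k (fun m => map ψ (pr (monomial m 1)))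
  have hN (m : σ →₀ ℕ) : N (monomial m 1) = map ψ (pr (monomial m 1)) := by
    simpa using (basisMonomials σ k).constr_basis k (fun m => map ψ (pr (monomial m 1))) m
  have h1 (h : MvPolynomial σ A) : N (map ψ h) = map ψ (pr h) := by
    induction h using MvPolynomial.monomial_add_induction_on with
    | C a => 
      have e1 : map ψ (C a) = ψ a • (monomial (0 : σ →₀ ℕ) (1 : k)) := by
        rw [map_C, smul_monomial]; simp
      have e2 : (C a : MvPolynomial σ A) = a • monomial 0 1 := by
        rw [smul_monomial]; simp
      rw [e1, e2, map_smul, map_smul, hN, smul_eq_C_mul, smul_eq_C_mul, map_mul, map_C]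
    | monomial_add m c f _ _ hf =>
      have e1 : map ψ (monomial m c) = ψ c • (monomial m (1 : k)) := by
        rw [map_monomial, smul_monomial]; simp
      have e2 : (monomial m c : MvPolynomial σ A) = c • monomial m 1 := by
        rw [smul_monomial]; simp
      rw [map_add, map_add, map_add, map_add, hf, e1, e2, map_smul, map_smul, hN,
        smul_eq_C_mul, smul_eq_C_mul, map_mul, map_C]
  have h2 (z) (hz : z ∈ (J.map (map ψ)).restrictScalars k) : N z = 0 := by
    rw [restrictScalars_map_eq_span] at hz
    suffices Submodule.span k (map ψ '' (J : Set (MvPolynomial σ A))) ≤ LinearMap.ker N from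
      this hz
    rw [Submodule.span_le]
    rintro _ ⟨h, hh, rfl⟩
    have : pr h = 0 := by
      simp only [pr, LinearMap.comp_apply]
      rw [(Submodule.projectionOnto_apply_eq_zero_iff H.symm).mpr hh, map_zero]
    change N _ = 0
    rw [h1, this, map_zero]
  have h3 (z) (hz : z ∈ restrictSupport k B) : N z = z := by
    rw [restrictSupport_eq_span] at hz
    suffices Submodule.span k ((monomial · (1 : k)) '' B) ≤ LinearMap.eqLocus N LinearMap.id from
      this hz
    rw [Submodule.span_le]
    rintro _ ⟨b, hb, rfl⟩
    change N (monomial b 1) = monomial b 1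
    rw [hN]
    have : pr (monomial b 1) = monomial b 1 := by
      simp only [pr, LinearMap.comp_apply]
      exact congrArg Subtype.val <| Submodule.projectionOnto_apply_left H.symm
        ⟨monomial b 1, (monomial_mem_restrictSupport ..).mpr (Or.inl hb)⟩
    rw [this]; simp
  constructor
  · rw [Submodule.disjoint_def]
    intro x hx hx'
    rw [← h3 x hx', h2 x hx]
  · rw [codisjoint_iff, eq_top_iff, ← restrictSupport_univ, restrictSupport_eq_span,
      Submodule.span_le]
    rintro _ ⟨m, -, rfl⟩
    have : (monomial m (1 : A)) ∈ J.restrictScalars A ⊔ restrictSupport A B := by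
      rw [H.sup_eq_top]; trivial
    obtain ⟨y, hy, z, hz, hyz⟩ := Submodule.mem_sup.mp this
    refine Submodule.mem_sup.mpr ⟨map ψ y, Ideal.mem_map_of_mem _ hy, map ψ z, ?_, ?_⟩
    · rw [mem_restrictSupport_iff] at hz ⊢
      exact (Finset.coe_subset.mpr (support_map_subset ψ z)).trans hz
    · simp [← map_add, hyz]

end Complement

/-! ### Finitely many monomial complements for all fields -/

/-- Generic freeness by Gröbner bases. `E` is the set of leading exponents of `J`, and by Dickson's
lemma it has finitely many minimal elements. Once the product `f` of the corresponding leading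
coefficients is inverted, division shows that the monomials outside `E` span the quotient. -/
theorem exists_isCompl_restrictSupport {σ A : Type*} [Finite σ] [CommRing A] [IsDomain A]
    (J : Ideal (MvPolynomial σ A)) :
    ∃ (f : A) (B : Set (σ →₀ ℕ)), f ≠ 0 ∧ ∀ {k : Type*} [CommRing k] (ψ : A →+* k),
      IsUnit (ψ f) → IsCompl ((J.map (map ψ)).restrictScalars k) (restrictSupport k B) := by
  classical
  obtain ⟨r, hr⟩ := exists_wellFoundedLT σ
  let o : MonomialOrder σ := MonomialOrder.lex
  let E : Set (σ →₀ ℕ) := {e | ∃ g ∈ J, g ≠ 0 ∧ o.degree g = e}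
  have hE : {e | Minimal (· ∈ E) e}.Finite := by
    apply WellQuasiOrderedLE.finite_of_isAntichain
    exact setOfPred_minimal_antichain _
  have hmin : ∀ e ∈ E, ∃ t, Minimal (· ∈ E) t ∧ t ≤ e := by
    intro e he
    obtain ⟨t, ht, ht'⟩ := exists_minimal_le_of_wellFoundedLT (· ∈ E) e he
    exact ⟨t, ht', ht⟩
  choose! g hgJ hg0 hgd using fun (e : σ →₀ ℕ) (he : e ∈ E) => he
  let T := hE.toFinset
  have hT : ∀ t ∈ T, t ∈ E := fun t ht => (hE.mem_toFinset.mp ht).prop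
  let f := ∏ t ∈ T, o.leadingCoeff (g t)
  have hf0 : f ≠ 0 := Finset.prod_ne_zero_iff.mpr fun t ht =>
    o.leadingCoeff_ne_zero_iff.mpr (hg0 t (hT t ht))
  refine ⟨f, Eᶜ, hf0, ?_⟩
  let L := Localization.Away f
  have hinj : Function.Injective (algebraMap A L) :=
    IsLocalization.injective L (powers_le_nonZeroDivisors_of_noZeroDivisors hf0)
  have key : IsCompl ((J.map (map (algebraMap A L))).restrictScalars L)
      (restrictSupport L Eᶜ) := by
    constructor
    · rw [Submodule.disjoint_def]
      intro x hx hxB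
      by_contra hx0
      -- Clearing denominators, `x` has the support of some nonzero `h ∈ J`, whose leading exponent
      -- lies in `E`, although `x` is supported off `E`.
      have : ∃ s ∈ Submonoid.powers f, ∃ h ∈ J, algebraMap A L s • x = map (algebraMap A L) h := by
        rw [restrictScalars_map_eq_span] at hx
        refine Submodule.span_induction (p := fun x _ => ∃ s ∈ Submonoid.powers f, ∃ h ∈ J,
          algebraMap A L s • x = map (algebraMap A L) h) ?_ ?_ ?_ ?_ hx
        · rintro _ ⟨h, hh, rfl⟩
          exact ⟨1, one_mem _, h, hh, by simp⟩
        · exact ⟨1, one_mem _, 0, J.zero_mem, by simp⟩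
        · rintro x y _ _ ⟨s, hs, h, hh, e⟩ ⟨s', hs', h', hh', e'⟩
          refine ⟨s * s', mul_mem hs hs', C s' * h + C s * h',
            add_mem (J.mul_mem_left _ hh) (J.mul_mem_left _ hh'), ?_⟩
          rw [(map (algebraMap A L)).map_add, (map (algebraMap A L)).map_mul,
            (map (algebraMap A L)).map_mul, ← e, ← e', map_C, map_C, smul_add, map_mul,
            ← smul_eq_C_mul, ← smul_eq_C_mul, smul_smul, smul_smul,
            mul_comm (algebraMap A L s) (algebraMap A L s')]
        · rintro c x _ ⟨s, hs, h, hh, e⟩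
          obtain ⟨⟨a, t⟩, hc⟩ := IsLocalization.surj (Submonoid.powers f) c
          refine ⟨s * t, mul_mem hs t.2, C a * h, J.mul_mem_left _ hh, ?_⟩
          rw [(map (algebraMap A L)).map_mul, ← e, map_C, ← smul_eq_C_mul, ← hc, smul_smul,
            smul_smul, map_mul]
          congr 1; ring
      obtain ⟨s, hs, h, hh, e⟩ := this
      have hsu : IsUnit (algebraMap A L s) := IsLocalization.map_units L ⟨s, hs⟩
      have hh0 : h ≠ 0 := by
        rintro rfl
        rw [map_zero, hsu.smul_eq_zero] at e
        exact hx0 e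
      have hd : o.degree h ∈ h.support := o.degree_mem_support hh0
      have : o.degree h ∈ x.support := by
        rw [mem_support_iff] at hd ⊢
        intro h0
        apply hd
        apply hinj
        rw [map_zero, ← coeff_map, ← e, coeff_smul, h0, smul_zero]
      exact hxB this ⟨h, hh, hh0, rfl⟩
    · rw [codisjoint_iff, eq_top_iff]
      intro x _
      have hlead : ∀ t : T, o.degree (map (algebraMap A L) (g t)) = t ∧
          IsUnit (o.leadingCoeff (map (algebraMap A L) (g t))) := by
        intro t
        have hs : (map (algebraMap A L) (g t)).support = (g t).support :=
          support_map_of_injective _ hinj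
        have hd : o.degree (map (algebraMap A L) (g t)) = t := by
          refine Eq.trans (o.toSyn.injective (le_antisymm ?_ ?_)) (hgd t (hT t t.2))
          · exact o.degree_le_iff.mpr fun c hc => o.le_degree (hs ▸ hc)
          · exact o.degree_le_iff.mpr fun c hc => o.le_degree (hs.symm ▸ hc)
        refine ⟨hd, ?_⟩
        have hf : IsUnit (algebraMap A L f) := IsLocalization.Away.algebraMap_isUnit f
        rw [MonomialOrder.leadingCoeff, hd, coeff_map]
        have := isUnit_of_dvd_unit (map_dvd (algebraMap A L)
          (Finset.dvd_prod_of_mem (fun t => o.leadingCoeff (g t)) t.2)) hf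
        rwa [MonomialOrder.leadingCoeff, hgd t (hT t t.2)] at this
      obtain ⟨q, r, h1, -, h3⟩ := o.div (fun t => (hlead t).2) x
      rw [h1]
      refine Submodule.add_mem_sup ?_ ?_
      · rw [Submodule.restrictScalars_mem, Finsupp.linearCombination_apply]
        exact Submodule.sum_mem _ fun t _ =>
          Ideal.mul_mem_left _ _ (Ideal.mem_map_of_mem _ (hgJ t (hT t t.2)))
      · rw [mem_restrictSupport_iff]
        intro c hc hcE
        obtain ⟨t, ht, htc⟩ := hmin c hcE
        refine h3 c hc ⟨t, hE.mem_toFinset.mpr ht⟩ ?_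
        rw [(hlead _).1]
        exact htc
  intro k _ ψ hψ
  have hmap : map (σ := σ) ψ = (map (IsLocalization.Away.lift f hψ : L →+* k)).comp
      (map (algebraMap A L)) := by
    ext x <;> simp
  rw [hmap, ← Ideal.map_map]
  exact isCompl_restrictSupport_map _ _ key

universe v

/-- Noetherian induction on the closed set cut out by `𝔞`: if `𝔞` is prime, one set works where the
generic `f` is invertible and the rest is a smaller closed set; otherwise the closed set is a union
of two smaller ones. -/
theorem exists_finite_isCompl_of_isNoetherianRing {σ R : Type*} [Finite σ] [CommRing R]
    [IsNoetherianRing R] (I : Ideal (MvPolynomial σ R)) (𝔞 : Ideal R) :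
    ∃ F : Set (Set (σ →₀ ℕ)), F.Finite ∧ ∀ {k : Type v} [Field k] (ψ : R →+* k),
      𝔞 ≤ RingHom.ker ψ →
        ∃ B ∈ F, IsCompl ((I.map (map ψ)).restrictScalars k) (restrictSupport k B) := by
  induction 𝔞 using IsNoetherian.induction with
  | hgt 𝔞 IH =>
  change Ideal R at 𝔞
  by_cases hp : 𝔞.IsPrime
  · obtain ⟨f, B, hf, hB⟩ := exists_isCompl_restrictSupport.{_, _, v}
      (I.map (map (Ideal.Quotient.mk 𝔞)))
    obtain ⟨f, rfl⟩ := Ideal.Quotient.mk_surjective f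
    have hf' : f ∉ 𝔞 := fun h => hf (Ideal.Quotient.eq_zero_iff_mem.mpr h)
    obtain ⟨F, hF, h⟩ := IH (𝔞 ⊔ Ideal.span {f}) (left_lt_sup.mpr fun hle =>
      hf' (hle (Ideal.mem_span_singleton_self f)))
    refine ⟨insert B F, hF.insert B, fun {k} _ ψ hψ => ?_⟩
    by_cases hψf : ψ f = 0
    · obtain ⟨B', hB', hc⟩ := h ψ (sup_le hψ (by
        rw [Ideal.span_singleton_le_iff_mem]; exact hψf))
      exact ⟨B', Set.mem_insert_of_mem _ hB', hc⟩
    · refine ⟨B, Set.mem_insert _ _, ?_⟩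
      have hψ' : ∀ a ∈ 𝔞, ψ a = 0 := fun a ha => hψ ha
      have := hB (Ideal.Quotient.lift 𝔞 ψ hψ') (by
        rw [Ideal.Quotient.lift_mk]; exact IsUnit.mk0 _ hψf)
      rw [Ideal.map_map] at this
      convert! this using 3
      apply ringHom_ext
      · intro x
        simp only [RingHom.comp_apply, map_C]
        rw [Ideal.Quotient.lift_mk]
      · simp
  · by_cases htop : 𝔞 = ⊤
    · refine ⟨∅, Set.finite_empty, fun {k} _ ψ hψ => ?_⟩
      exact absurd (hψ (htop ▸ Submodule.mem_top : (1 : R) ∈ 𝔞)) (by simp)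
    · obtain ⟨x, hx, y, hy, hxy⟩ := (Ideal.not_isPrime_iff.mp hp).resolve_left htop
      obtain ⟨F, hF, h⟩ := IH (𝔞 ⊔ Ideal.span {x}) (left_lt_sup.mpr fun hle =>
        hx (hle (Ideal.mem_span_singleton_self x)))
      obtain ⟨F', hF', h'⟩ := IH (𝔞 ⊔ Ideal.span {y}) (left_lt_sup.mpr fun hle =>
        hy (hle (Ideal.mem_span_singleton_self y)))
      refine ⟨F ∪ F', hF.union hF', fun {k} _ ψ hψ => ?_⟩
      have : ψ x * ψ y = 0 := by rw [← map_mul]; exact hψ hxy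
      rcases mul_eq_zero.mp this with h0 | h0
      · obtain ⟨B, hB, hc⟩ := h ψ (sup_le hψ (by
          rw [Ideal.span_singleton_le_iff_mem]; exact h0))
        exact ⟨B, Or.inl hB, hc⟩
      · obtain ⟨B, hB, hc⟩ := h' ψ (sup_le hψ (by
          rw [Ideal.span_singleton_le_iff_mem]; exact h0))
        exact ⟨B, Or.inr hB, hc⟩

/-- A finitely generated ideal is already defined over the subring generated by its finitely many
coefficients, which is Noetherian. -/
theorem exists_finite_isCompl {σ R : Type*} [Finite σ] [CommRing R]
    (I : Ideal (MvPolynomial σ R)) (hI : I.FG) :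
    ∃ F : Set (Set (σ →₀ ℕ)), F.Finite ∧ ∀ {k : Type v} [Field k] (ψ : R →+* k),
        ∃ B ∈ F, IsCompl ((I.map (map ψ)).restrictScalars k) (restrictSupport k B) := by
  classical
  obtain ⟨s, rfl⟩ := hI
  let c : Finset R := s.biUnion fun g => g.support.image fun m => g.coeff m
  let R₀ := Algebra.adjoin ℤ (c : Set R)
  have : IsNoetherianRing R₀ := isNoetherianRing_of_fg (Subalgebra.fg_adjoin_finset c)
  have hs : ∀ g ∈ s, ∃ g₀ : MvPolynomial σ R₀, map (algebraMap R₀ R) g₀ = g := by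
    intro g hg
    change g ∈ Set.range (map (algebraMap R₀ R))
    rw [mem_range_map_iff_coeffs_subset]
    intro a ha
    obtain ⟨m, hm, rfl⟩ := mem_coeffs_iff.mp ha
    exact ⟨⟨_, Algebra.subset_adjoin (Finset.mem_coe.mpr (Finset.mem_biUnion.mpr
      ⟨g, hg, Finset.mem_image_of_mem _ hm⟩))⟩, rfl⟩
  choose! l hl using hs
  obtain ⟨F, hF, h⟩ := exists_finite_isCompl_of_isNoetherianRing
    (Ideal.span (l '' (s : Set (MvPolynomial σ R)))) ⊥
  refine ⟨F, hF, fun {k} _ ψ => ?_⟩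
  obtain ⟨B, hB, hc⟩ := h (ψ.comp (algebraMap R₀ R)) bot_le
  refine ⟨B, hB, ?_⟩
  have hmap : map (σ := σ) (ψ.comp (algebraMap R₀ R)) = (map ψ).comp (map (algebraMap R₀ R)) := by
    ext x <;> simp
  have hspan : (Ideal.span (l '' (s : Set (MvPolynomial σ R)))).map (map (algebraMap R₀ R)) =
      Ideal.span (s : Set (MvPolynomial σ R)) := by
    rw [Ideal.map_span, Set.image_image]
    congr 1
    ext x
    constructor
    · rintro ⟨y, hy, rfl⟩
      change map _ (l y) ∈ _
      rw [hl y hy]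
      exact hy
    · exact fun hx => ⟨x, hx, hl x hx⟩
  rwa [hmap, ← Ideal.map_map, hspan] at hc

end MvPolynomial

/-! ### Nakayama's lemma at a prime, degree by degree -/

/-- Nakayama by the determinant trick: Cayley–Hamilton gives a monic `p` with lower coefficients in
`q` such that `p.eval a` kills `M`, and `p.eval a` is a power of `a` modulo `q`. -/
theorem Module.Finite.exists_notMem_smul_eq_zero {R M : Type*} [CommRing R] [AddCommGroup M]
    [Module R M] [Module.Finite R M] (q : Ideal R) [q.IsPrime] {a : R} (ha : a ∉ q)
    (h : ∀ x : M, a • x ∈ q • (⊤ : Submodule R M)) : ∃ b ∉ q, ∀ x : M, b • x = 0 := by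
  obtain ⟨p, hp, -, hc, h0⟩ :=
    LinearMap.exists_monic_and_natDegree_eq_and_coeff_mem_pow_and_aeval_eq_zero R
      (LinearMap.lsmul R M a) q (by rintro _ ⟨x, rfl⟩; exact h x)
  refine ⟨p.eval a, fun hpa => ha ?_, fun x => ?_⟩
  · have : p.eval a - a ^ p.natDegree ∈ q := by
      rw [Polynomial.eval_eq_sum_range, Finset.sum_range_succ, hp.coeff_natDegree, one_mul,
        add_sub_cancel_right]
      refine Ideal.sum_mem _ fun i hi => Ideal.mul_mem_right _ _ ?_
      exact Ideal.pow_le_self (Nat.sub_ne_zero_of_lt (Finset.mem_range.mp hi)) (hc i)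
    exact Ideal.IsPrime.mem_of_pow_mem ‹_› _ ((Submodule.sub_mem_iff_right q hpa).mp this)
  · have h1 := LinearMap.congr_fun h0 x
    have : LinearMap.lsmul R M a = algebraMap R (Module.End R M) a := rfl
    rwa [this, Polynomial.aeval_algebraMap_apply, Polynomial.coe_aeval_eq_eval] at h1

namespace MvPolynomial

variable {σ R k : Type*} [CommRing R] [Field k]

theorem exists_smul_eq_map_of_mem_span (ψ : R →+* k)
    (hψ : ∀ c : k, ∃ r s, ψ s ≠ 0 ∧ c * ψ s = ψ r) (M : Submodule R (MvPolynomial σ R))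
    {z : MvPolynomial σ k}
    (hz : z ∈ Submodule.span k (map ψ '' (M : Set (MvPolynomial σ R)))) :
    ∃ a, ψ a ≠ 0 ∧ ∃ h ∈ M, ψ a • z = map ψ h := by
  have hmap (a : R) (h : MvPolynomial σ R) : map ψ (a • h) = ψ a • map ψ h := by
    rw [smul_eq_C_mul, map_mul, map_C, smul_eq_C_mul]
  refine Submodule.span_induction (p := fun z _ => ∃ a, ψ a ≠ 0 ∧ ∃ h ∈ M, ψ a • z = map ψ h)
    ?_ ⟨1, by simp, 0, M.zero_mem, by simp⟩ ?_ ?_ hz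
  · rintro _ ⟨h, hh, rfl⟩
    exact ⟨1, by simp, h, hh, by simp⟩
  · rintro x y _ _ ⟨a, ha, h, hh, e⟩ ⟨a', ha', h', hh', e'⟩
    refine ⟨a * a', by simp [ha, ha'], a' • h + a • h',
      add_mem (M.smul_mem _ hh) (M.smul_mem _ hh'), ?_⟩
    rw [(map ψ).map_add, hmap, hmap, ← e, ← e', smul_add, map_mul, smul_smul, smul_smul,
      mul_comm (ψ a) (ψ a')]
  · rintro c x _ ⟨a, ha, h, hh, e⟩
    obtain ⟨r, s, hs, hc⟩ := hψ c
    refine ⟨a * s, by simp [ha, hs], r • h, M.smul_mem _ hh, ?_⟩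
    rw [hmap, ← e, ← hc, smul_smul, smul_smul, map_mul]
    congr 1; ring

/-- The forms of degree `e` are a finite `R`-module, so Nakayama lifts spanning over the residue
field to spanning over the localisation at `q`. The multiplier `a` depends on `e`. -/
theorem exists_smul_monomial_mem_sup [Finite σ] (q : Ideal R) [q.IsPrime] (ψ : R →+* k)
    (hker : RingHom.ker ψ = q)
    (hψ : ∀ c : k, ∃ r s, ψ s ≠ 0 ∧ c * ψ s = ψ r)
    {I : Ideal (MvPolynomial σ R)} (hI : ∀ x ∈ I, ∀ e, homogeneousComponent e x ∈ I)
    {B : Set (σ →₀ ℕ)}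
    (H : (I.map (map ψ)).restrictScalars k ⊔ restrictSupport k B = ⊤) (e : ℕ) :
    ∃ a ∉ q, ∀ m : σ →₀ ℕ, m.degree = e →
      a • monomial m (1 : R) ∈ I.restrictScalars R ⊔ restrictSupport R {b ∈ B | b.degree = e} := by
  classical
  set W := I.restrictScalars R ⊔ restrictSupport R {b ∈ B | b.degree = e} with hW
  let M := I.restrictScalars R ⊔ restrictSupport R B
  have hspan : Submodule.span k (map ψ '' (M : Set (MvPolynomial σ R))) = ⊤ := by
    rw [eq_top_iff, ← H, sup_le_iff]
    constructor
    · rw [restrictScalars_map_eq_span]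
      exact Submodule.span_mono (Set.image_mono fun x hx => Submodule.mem_sup_left hx)
    · rw [restrictSupport_eq_span, Submodule.span_le]
      rintro _ ⟨b, hb, rfl⟩
      refine Submodule.subset_span ⟨monomial b 1, Submodule.mem_sup_right
        ((monomial_mem_restrictSupport ..).mpr (Or.inl hb)), by simp⟩
  let P := homogeneousSubmodule σ R e
  have hP : P = Submodule.span R ((monomial · (1 : R)) '' {m : σ →₀ ℕ | m.degree = e}) := by
    rw [← restrictSupport_eq_span]
    exact homogeneousSubmodule_eq_finsupp_supported _ _ e
  have hqP : ∀ y ∈ P, map ψ y = 0 → y ∈ q • P := by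
    intro y hy hy0
    rw [y.as_sum]
    refine Submodule.sum_mem _ fun m hm => ?_
    have : monomial m (coeff m y) = coeff m y • monomial m (1 : R) := by simp [smul_monomial]
    rw [this]
    refine Submodule.smul_mem_smul ?_ ?_
    · rw [← hker, RingHom.mem_ker, ← coeff_map, hy0, coeff_zero]
    · rw [hP]
      refine Submodule.subset_span ⟨m, ?_, rfl⟩
      by_contra hne
      exact (mem_support_iff.mp hm) (IsHomogeneous.coeff_eq_zero (hφ := hy) hne)
  have key : ∀ m : σ →₀ ℕ, m.degree = e → ∃ a ∉ q, a • monomial m (1 : R) ∈ W ⊔ q • P := by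
    intro m hm
    obtain ⟨a, ha, h, hh, eq⟩ := exists_smul_eq_map_of_mem_span ψ hψ M
      (z := monomial m 1) (by rw [hspan]; trivial)
    refine ⟨a, fun h => ha (by rwa [← hker] at h), ?_⟩
    have hmon : (monomial m (1 : R)).IsHomogeneous e := isHomogeneous_monomial _ hm
    have hhe : homogeneousComponent e h ∈ W := by
      obtain ⟨i, hi, b, hb, rfl⟩ := Submodule.mem_sup.mp hh
      rw [map_add]
      refine Submodule.add_mem_sup (hI i hi e) ?_
      rw [mem_restrictSupport_iff]
      intro c hc
      rw [Finset.mem_coe, mem_support_iff, coeff_homogeneousComponent] at hc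
      split_ifs at hc with hce
      · exact ⟨hb (mem_support_iff.mpr hc), hce⟩
      · exact absurd rfl hc
    -- The difference is a form of degree `e` vanishing over `k`, so its coefficients lie in `q`.
    have hy : a • monomial m (1 : R) - homogeneousComponent e h ∈ q • P := by
      refine hqP _ (P.sub_mem (P.smul_mem _ hmon) (homogeneousComponent_isHomogeneous _ _)) ?_
      have h0 : map ψ (a • monomial m (1 : R) - h) = 0 := by
        rw [map_sub, ← eq, smul_eq_C_mul, map_mul, map_C, map_monomial, map_one, smul_eq_C_mul,
          sub_self]
      ext c
      have h1 := congrArg (coeff c) h0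
      rw [coeff_map, coeff_zero, coeff_sub] at h1 ⊢
      rw [coeff_homogeneousComponent]
      split_ifs with hc
      · exact h1
      · rw [coeff_smul, coeff_monomial, if_neg (by rintro rfl; exact hc hm)]
        simp
    rw [← sub_add_cancel (a • monomial m (1 : R)) (homogeneousComponent e h), add_comm]
    exact Submodule.add_mem_sup hhe hy
  choose! a ha hmem using key
  have hfin : {m : σ →₀ ℕ | m.degree = e}.Finite := Finsupp.finite_of_degree_eq e
  let a₀ := ∏ m ∈ hfin.toFinset, a m
  have ha₀ : a₀ ∉ q := by
    intro h
    obtain ⟨m, hm, hm'⟩ := (Ideal.IsPrime.prod_mem_iff (hp := ‹q.IsPrime›)).mp h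
    exact ha m (hfin.mem_toFinset.mp hm) hm'
  have haP : ∀ y ∈ P, a₀ • y ∈ W ⊔ q • P := by
    intro y hy
    rw [hP] at hy
    suffices Submodule.span R ((monomial · (1 : R)) '' {m : σ →₀ ℕ | m.degree = e}) ≤
      (W ⊔ q • P).comap (LinearMap.lsmul R _ a₀) from this hy
    rw [Submodule.span_le]
    rintro _ ⟨m, hm, rfl⟩
    change a₀ • monomial m (1 : R) ∈ W ⊔ q • P
    obtain ⟨c, hc⟩ := Finset.dvd_prod_of_mem a (hfin.mem_toFinset.mpr hm)
    have : a₀ = c * a m := by rw [mul_comm]; exact hc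
    rw [this, mul_smul]
    exact Submodule.smul_mem _ _ (hmem m hm)
  have hPfg : P.FG := homogeneousSubmodule_fg _ _ e
  let Q := P.map W.mkQ
  have : Module.Finite R Q := Module.Finite.iff_fg.mpr (hPfg.map _)
  obtain ⟨b, hb, hb0⟩ := Module.Finite.exists_notMem_smul_eq_zero (M := Q) q ha₀ (by
    rintro ⟨_, y, hy, rfl⟩
    have h1 : W.mkQ (a₀ • y) ∈ q • Q := by
      obtain ⟨w, hw, z, hz, e⟩ := Submodule.mem_sup.mp (haP y hy)
      rw [← e, map_add, show W.mkQ w = 0 from (Submodule.Quotient.mk_eq_zero W).mpr hw, zero_add]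
      rw [← Submodule.map_smul'']
      exact Submodule.mem_map_of_mem hz
    have h2 : q • (⊤ : Submodule R Q) = (q • Q).comap Q.subtype := by
      apply Submodule.map_injective_of_injective Q.subtype_injective
      rw [Submodule.map_smul'', Submodule.map_subtype_top, Submodule.map_comap_subtype,
        inf_eq_right.mpr Submodule.smul_le_right]
    rw [h2]
    exact h1)
  refine ⟨b, hb, fun m hm => ?_⟩
  have := hb0 ⟨W.mkQ (monomial m 1), Submodule.mem_map_of_mem (isHomogeneous_monomial _ hm)⟩
  rw [← (Submodule.Quotient.mk_eq_zero W), ← Submodule.mkQ_apply, map_smul]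
  exact congrArg Subtype.val this

end MvPolynomial

/-! ### Dimension counts and homogeneous ideals -/

namespace MvPolynomial

section Field

variable {σ k : Type*} [Field k]

theorem finrank_restrictSupport (B : Set (σ →₀ ℕ)) :
    Module.finrank k (restrictSupport k B) = B.ncard := by
  rw [Module.finrank_eq_nat_card_basis (basisRestrictSupport k B), Nat.card_coe_set_eq]

/-- Modulo `J` the monomials of `B` are independent and lie in the span of those of `C`; if `C` is
no larger, its monomials must be independent too. -/
theorem ncard_le_and_disjoint_of_le_sup {J : Submodule k (MvPolynomial σ k)}
    {B C : Set (σ →₀ ℕ)} (hB : B.Finite) (hC : C.Finite) (h₁ : Disjoint J (restrictSupport k B))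
    (h₂ : restrictSupport k B ≤ J ⊔ restrictSupport k C) :
    B.ncard ≤ C.ncard ∧ (C.ncard ≤ B.ncard → Disjoint J (restrictSupport k C)) := by
  have := hB.to_subtype
  have := hC.to_subtype
  have : Module.Finite k (restrictSupport k B) := .of_basis (basisRestrictSupport k B)
  have : Module.Finite k (restrictSupport k C) := .of_basis (basisRestrictSupport k C)
  let g (D : Set (σ →₀ ℕ)) := J.mkQ ∘ₗ (restrictSupport k D).subtype
  have hker (D) : LinearMap.ker (g D) = ⊥ ↔ Disjoint J (restrictSupport k D) := by
    rw [LinearMap.ker_comp, Submodule.ker_mkQ, disjoint_comm, Submodule.disjoint_iff_comap_eq_bot]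
  have hle : LinearMap.range (g B) ≤ LinearMap.range (g C) := by
    rintro _ ⟨x, rfl⟩
    obtain ⟨j, hj, c, hc, e⟩ := Submodule.mem_sup.mp (h₂ x.2)
    refine ⟨⟨c, hc⟩, ?_⟩
    change J.mkQ c = J.mkQ x
    rw [← e, map_add, show J.mkQ j = 0 from (Submodule.Quotient.mk_eq_zero J).mpr hj, zero_add]
  have h3 := Submodule.finrank_mono hle
  have h4 := (g B).finrank_range_add_finrank_ker
  have h5 := (g C).finrank_range_add_finrank_ker
  rw [finrank_restrictSupport] at h4 h5
  rw [(hker B).mpr h₁, finrank_bot] at h4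
  refine ⟨by omega, fun h => (hker C).mp ?_⟩
  rw [← Submodule.finrank_eq_zero (R := k)]
  omega

end Field

section Homogeneous

variable {σ R : Type*} [CommRing R]

theorem homogeneousComponent_mem_restrictSupport {B : Set (σ →₀ ℕ)} {x : MvPolynomial σ R}
    (hx : x ∈ restrictSupport R B) (e : ℕ) :
    homogeneousComponent e x ∈ restrictSupport R {b ∈ B | b.degree = e} := by
  classical
  rw [mem_restrictSupport_iff]
  intro c hc
  rw [Finset.mem_coe, mem_support_iff, coeff_homogeneousComponent] at hc
  split_ifs at hc with hce
  · exact ⟨hx (mem_support_iff.mpr hc), hce⟩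
  · exact absurd rfl hc

theorem restrictSupport_le_sup_of_sup_eq_top {I : Ideal (MvPolynomial σ R)}
    (hI : ∀ x ∈ I, ∀ e, homogeneousComponent e x ∈ I) {B C : Set (σ →₀ ℕ)}
    (H : I.restrictScalars R ⊔ restrictSupport R C = ⊤) (e : ℕ) :
    restrictSupport R {b ∈ B | b.degree = e} ≤
      I.restrictScalars R ⊔ restrictSupport R {b ∈ C | b.degree = e} := by
  rw [restrictSupport_eq_span, Submodule.span_le]
  rintro _ ⟨b, ⟨-, hb⟩, rfl⟩
  obtain ⟨y, hy, z, hz, hyz⟩ := Submodule.mem_sup.mp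
    (H.ge (Submodule.mem_top (x := monomial b (1 : R))))
  have := congrArg (homogeneousComponent e) hyz
  rw [homogeneousComponent_eq_self (isHomogeneous_monomial _ hb), map_add] at this
  change monomial b (1 : R) ∈ _
  rw [← this]
  exact Submodule.add_mem_sup (hI y hy e) (homogeneousComponent_mem_restrictSupport hz e)

theorem smul_mem_of_isHomogeneous {W : Submodule R (MvPolynomial σ R)} {a : R} {e : ℕ}
    (h : ∀ m : σ →₀ ℕ, m.degree = e → a • monomial m (1 : R) ∈ W) {x : MvPolynomial σ R}
    (hx : x.IsHomogeneous e) : a • x ∈ W := by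
  rw [x.as_sum, Finset.smul_sum]
  refine Submodule.sum_mem _ fun m hm => ?_
  have : a • monomial m (coeff m x) = coeff m x • (a • monomial m (1 : R)) := by
    simp [smul_monomial, mul_comm]
  rw [this]
  refine W.smul_mem _ (h m ?_)
  by_contra hne
  exact (mem_support_iff.mp hm) (hx.coeff_eq_zero hne)

theorem map_monomial_mem_sup_map {k : Type*} [Field k] (ψ : R →+* k) {a : R} (ha : ψ a ≠ 0)
    {I : Ideal (MvPolynomial σ R)} {C : Set (σ →₀ ℕ)} {m : σ →₀ ℕ}
    (h : a • monomial m (1 : R) ∈ I.restrictScalars R ⊔ restrictSupport R C) :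
    monomial m (1 : k) ∈ (I.map (map ψ)).restrictScalars k ⊔ restrictSupport k C := by
  obtain ⟨y, hy, z, hz, hyz⟩ := Submodule.mem_sup.mp h
  have := congrArg (map ψ) hyz
  rw [map_add, smul_eq_C_mul, map_mul, map_C, map_monomial, map_one, ← smul_eq_C_mul] at this
  rw [← Submodule.smul_mem_iff _ ha, ← this]
  refine Submodule.add_mem_sup (Ideal.mem_map_of_mem _ hy) ?_
  rw [mem_restrictSupport_iff] at hz ⊢
  exact (Finset.coe_subset.mpr (support_map_subset ψ z)).trans hz

theorem restrictSupport_le_sup_map {k : Type*} [Field k] (ψ : R →+* k) {a : R} (ha : ψ a ≠ 0)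
    {I : Ideal (MvPolynomial σ R)} {B C : Set (σ →₀ ℕ)} {e : ℕ}
    (h : ∀ m : σ →₀ ℕ, m.degree = e →
      a • monomial m (1 : R) ∈ I.restrictScalars R ⊔ restrictSupport R C) :
    restrictSupport k {b ∈ B | b.degree = e} ≤
      (I.map (map ψ)).restrictScalars k ⊔ restrictSupport k C := by
  rw [restrictSupport_eq_span, Submodule.span_le]
  rintro _ ⟨b, ⟨-, hb⟩, rfl⟩
  exact map_monomial_mem_sup_map ψ ha (h b hb)

theorem homogeneousComponent_mem_map {k : Type*} [CommRing k] (ψ : R →+* k)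
    {I : Ideal (MvPolynomial σ R)} (hI : ∀ x ∈ I, ∀ e, homogeneousComponent e x ∈ I) :
    ∀ x ∈ I.map (map ψ), ∀ e, homogeneousComponent e x ∈ I.map (map ψ) := by
  intro x hx e
  change x ∈ (I.map (map ψ)).restrictScalars k at hx
  change _ ∈ (I.map (map ψ)).restrictScalars k
  rw [restrictScalars_map_eq_span] at hx ⊢
  suffices Submodule.span k (map ψ '' (I : Set (MvPolynomial σ R))) ≤
    (Submodule.span k (map ψ '' (I : Set (MvPolynomial σ R)))).comap (homogeneousComponent e) from
    this hx
  rw [Submodule.span_le]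
  rintro _ ⟨h, hh, rfl⟩
  refine Submodule.subset_span ⟨_, hI h hh e, ?_⟩
  classical
  ext c
  rw [coeff_map, coeff_homogeneousComponent, coeff_homogeneousComponent, coeff_map]
  split_ifs <;> simp

/-- By Hilbert's basis theorem over `k`, finitely many elements of `I` generate the image; their
homogeneous components still lie in `I`. -/
theorem exists_fg_homogeneous_le_map_eq [Finite σ] {k : Type*} [Field k] (ψ : R →+* k)
    {I : Ideal (MvPolynomial σ R)} (hI : ∀ x ∈ I, ∀ e, homogeneousComponent e x ∈ I) :
    ∃ I' ≤ I, I'.FG ∧ (∀ x ∈ I', ∀ e, homogeneousComponent e x ∈ I') ∧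
      I'.map (map ψ) = I.map (map ψ) := by
  classical
  obtain ⟨T, hT, hT'⟩ := (Submodule.fg_span_iff_fg_span_finset_subset
    (map ψ '' (I : Set (MvPolynomial σ R)))).mp (IsNoetherian.noetherian (I.map (map ψ)))
  obtain ⟨T', hT'', rfl⟩ := Finset.subset_set_image_iff.mp hT
  let G : Finset (MvPolynomial σ R) :=
    T'.biUnion fun t => (Finset.range (t.totalDegree + 1)).image fun e => homogeneousComponent e t
  have hG : ∀ g ∈ G, g ∈ I ∧ ∃ n, g.IsHomogeneous n := by
    intro g hg
    simp only [G, Finset.mem_biUnion, Finset.mem_image] at hg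
    obtain ⟨t, ht, e, -, rfl⟩ := hg
    exact ⟨hI _ (hT'' ht) _, e, homogeneousComponent_isHomogeneous _ _⟩
  refine ⟨Ideal.span G, Ideal.span_le.mpr fun g hg => (hG g hg).1, ⟨G, rfl⟩, ?_, ?_⟩
  · intro x hx e
    let _ := gradedAlgebra (σ := σ) (R := R)
    refine homogeneousComponent_mem_of_mem ?_ hx e
    exact Ideal.homogeneous_span _ _ fun g hg => by
      obtain ⟨n, hn⟩ := (hG g hg).2
      exact ⟨n, hn⟩
  · apply le_antisymm
    · exact Ideal.map_mono (Ideal.span_le.mpr fun g hg => (hG g hg).1)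
    · refine hT'.le.trans ?_
      refine Ideal.span_le.mpr ?_
      intro y hy
      obtain ⟨t, ht, rfl⟩ := Finset.mem_image.mp hy
      refine Ideal.mem_map_of_mem _ ?_
      rw [← t.sum_homogeneousComponent]
      refine Ideal.sum_mem _ fun e he => Ideal.subset_span ?_
      exact Finset.mem_biUnion.mpr ⟨t, ht, Finset.mem_image_of_mem _ he⟩

theorem exists_smul_mem_of_isHomogeneous {I I' : Ideal (MvPolynomial σ R)}
    (hI : ∀ x ∈ I, ∀ e, homogeneousComponent e x ∈ I) (q : Ideal R) [q.IsPrime]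
    (h : ∀ e, ∀ x ∈ I, x.IsHomogeneous e → ∃ b ∉ q, b • x ∈ I') :
    ∀ x ∈ I, ∃ b ∉ q, b • x ∈ I' := by
  intro x hx
  choose b hb hb' using fun e => h e _ (hI x hx e) (homogeneousComponent_isHomogeneous e x)
  refine ⟨∏ e ∈ Finset.range (x.totalDegree + 1), b e, fun hp => ?_, ?_⟩
  · obtain ⟨e, -, he⟩ := (Ideal.IsPrime.prod_mem_iff (hp := ‹q.IsPrime›)).mp hp
    exact hb e he
  · nth_rewrite 2 [← x.sum_homogeneousComponent]
    rw [Finset.smul_sum]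
    refine Ideal.sum_mem _ fun e he => ?_
    obtain ⟨c, hc⟩ := Finset.dvd_prod_of_mem b he
    rw [hc, mul_comm, mul_smul]
    exact Submodule.smul_of_tower_mem I' c (hb' e)

end Homogeneous

end MvPolynomial

/-! ### Divisibility at a prime and saturation -/

/-- Denominator-free form of a fact on valuation rings: among finitely many elements, one divides
all the others. -/
theorem exists_mem_forall_dvd_mul {R ι : Type*} [CommRing R] (p : Ideal R) [p.IsPrime]
    (hp : ∀ x y : R, ∃ a ∉ p, x ∣ a * y ∨ y ∣ a * x) (c : ι → R) {s : Finset ι}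
    (hs : s.Nonempty) : ∃ i₀ ∈ s, ∃ a ∉ p, ∀ i ∈ s, c i₀ ∣ a * c i := by
  classical
  have hmul {a b : R} (ha : a ∉ p) (hb : b ∉ p) : a * b ∉ p := fun h =>
    (Ideal.IsPrime.mem_or_mem ‹_› h).elim ha hb
  induction hs using Finset.Nonempty.cons_induction with
  | singleton j =>
    refine ⟨j, Finset.mem_singleton_self j, 1, (Ideal.ne_top_iff_one p).mp Ideal.IsPrime.ne_top',
      fun i hi => ?_⟩
    rw [Finset.mem_singleton.mp hi, one_mul]
  | cons j s hj hs ih =>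
    obtain ⟨i₀, hi₀, a, ha, h⟩ := ih
    obtain ⟨b, hb, hd | hd⟩ := hp (c i₀) (c j)
    · refine ⟨i₀, Finset.mem_cons_of_mem hi₀, a * b, hmul ha hb, fun i hi => ?_⟩
      rcases Finset.mem_cons.mp hi with rfl | hi
      · rw [mul_assoc]; exact hd.mul_left _
      · rw [mul_right_comm]; exact (h i hi).mul_right _
    · refine ⟨j, Finset.mem_cons_self j s, a * b, hmul ha hb, fun i hi => ?_⟩
      rcases Finset.mem_cons.mp hi with rfl | hi
      · exact dvd_mul_left _ _
      · refine hd.trans ?_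
        rw [mul_comm a b, mul_assoc]
        exact mul_dvd_mul_left b (h i hi)

theorem Set.Finite.exists_bound_forall_eq {α : Type*} {F : Set α} (hF : F.Finite)
    (h : α → ℕ → ℕ) :
    ∃ D, ∀ a ∈ F, ∀ b ∈ F, (∀ e ≤ D, h a e = h b e) → ∀ e, h a e = h b e := by
  classical
  have : ∀ x : α × α, ∃ n, (∃ e, h x.1 e ≠ h x.2 e) → h x.1 n ≠ h x.2 n := by
    intro x
    by_cases hx : ∃ e, h x.1 e ≠ h x.2 e
    · obtain ⟨e, he⟩ := hx
      exact ⟨e, fun _ => he⟩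
    · exact ⟨0, fun h => absurd h hx⟩
  choose n hn using this
  refine ⟨((hF.prod hF).toFinset).sup n, fun a ha b hb hab e => ?_⟩
  by_contra he
  exact hn (a, b) ⟨e, he⟩ (hab _ (Finset.le_sup (f := n)
    ((hF.prod hF).mem_toFinset.mpr ⟨ha, hb⟩)))

theorem Ideal.exists_algebraMap_residueField_mul_eq {R : Type*} [CommRing R] (q : Ideal R)
    [q.IsPrime] (c : q.ResidueField) : ∃ r s, algebraMap R q.ResidueField s ≠ 0 ∧
      c * algebraMap R q.ResidueField s = algebraMap R q.ResidueField r := by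
  obtain ⟨⟨r, s, hs⟩, h⟩ := IsLocalization.surj (nonZeroDivisors (R ⧸ q)) c
  obtain ⟨r, rfl⟩ := Ideal.Quotient.mk_surjective r
  obtain ⟨s, rfl⟩ := Ideal.Quotient.mk_surjective s
  refine ⟨r, s, ?_, h⟩
  intro h0
  refine nonZeroDivisors.ne_zero hs ?_
  rw [Ideal.Quotient.eq_zero_iff_mem, ← q.ker_algebraMap_residueField]
  exact h0

namespace MvPolynomial

variable {σ R : Type*} [CommRing R]

/-- A relation among monomials of `B` can, up to a multiplier outside `p`, be divided by a
coefficient dividing all others. Saturation keeps the result in `I`, and it is a nonzero relation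
over `k`. -/
theorem disjoint_restrictSupport_of_forall_dvd [IsDomain R] {k : Type*} [Field k]
    (p : Ideal R) [p.IsPrime]
    (hp : ∀ x y : R, ∃ a ∉ p, x ∣ a * y ∨ y ∣ a * x) (ψ : R →+* k) (hψ : RingHom.ker ψ = p)
    {I : Ideal (MvPolynomial σ R)} (hsat : ∀ (r : R) (x), r ≠ 0 → r • x ∈ I → x ∈ I)
    {B : Set (σ →₀ ℕ)}
    (h : Disjoint ((I.map (map ψ)).restrictScalars k) (restrictSupport k B)) :
    Disjoint (I.restrictScalars R) (restrictSupport R B) := by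
  rw [Submodule.disjoint_def] at h ⊢
  intro x hx hxB
  by_contra hx0
  obtain ⟨i₀, hi₀, a, ha, hd⟩ := exists_mem_forall_dvd_mul p hp x.coeff
    (s := x.support) (support_nonempty.mpr hx0)
  choose! d hd using hd
  have hc0 : coeff i₀ x ≠ 0 := mem_support_iff.mp hi₀
  let y := ∑ i ∈ x.support, monomial i (d i)
  have hy : coeff i₀ x • y = a • x := by
    refine Eq.trans ?_ (congrArg (a • ·) x.as_sum.symm)
    rw [Finset.smul_sum, Finset.smul_sum]
    refine Finset.sum_congr rfl fun i hi => ?_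
    rw [smul_monomial, smul_monomial, smul_eq_mul, smul_eq_mul, hd i hi]
  have hyI : y ∈ I := hsat _ _ hc0 (hy ▸ Submodule.smul_of_tower_mem I a hx)
  have hyB : y ∈ restrictSupport R B := Submodule.sum_mem _ fun i hi =>
    (monomial_mem_restrictSupport ..).mpr (Or.inl (hxB hi))
  have h0 := h (map ψ y) (Ideal.mem_map_of_mem _ hyI) (by
    rw [mem_restrictSupport_iff] at hyB ⊢
    exact (Finset.coe_subset.mpr (support_map_subset ψ y)).trans hyB)
  have h1 := congrArg (coeff i₀) h0
  classical
  rw [coeff_map, coeff_zero, coeff_sum, Finset.sum_eq_single i₀ (fun b _ hb => by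
    rw [coeff_monomial, if_neg hb]) (fun h => absurd hi₀ h), coeff_monomial, if_pos rfl] at h1
  apply ha
  have h2 : d i₀ ∈ p := by rw [← hψ]; exact h1
  have h3 := hd i₀ hi₀
  rw [mul_comm] at h3
  rwa [mul_left_cancel₀ hc0 h3]

end MvPolynomial

/-! ### Finite generation of saturated homogeneous ideals -/

namespace MvPolynomial

variable {σ : Type*} {R : Type u} [CommRing R]

theorem disjoint_map_restrictSupport_of_injective {k : Type*} [Field k] (ψ : R →+* k)
    (hinj : Function.Injective ψ) (hψ : ∀ c : k, ∃ r s, ψ s ≠ 0 ∧ c * ψ s = ψ r)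
    {I : Ideal (MvPolynomial σ R)} {B : Set (σ →₀ ℕ)}
    (h : Disjoint (I.restrictScalars R) (restrictSupport R B)) :
    Disjoint ((I.map (map ψ)).restrictScalars k) (restrictSupport k B) := by
  rw [Submodule.disjoint_def] at h ⊢
  intro x hx hxB
  rw [restrictScalars_map_eq_span] at hx
  obtain ⟨a, ha, y, hy, e⟩ := exists_smul_eq_map_of_mem_span ψ hψ (I.restrictScalars R) hx
  have hyB : y ∈ restrictSupport R B := by
    rw [mem_restrictSupport_iff, ← support_map_of_injective y hinj, ← e]
    exact (restrictSupport k B).smul_mem _ hxB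
  rw [h y hy hyB, map_zero, smul_eq_zero] at e
  exact e.resolve_left ha

/-- Let `B`, `B₀`, `Bq` be the monomial complements at `p`, over the fraction field and at `q`. In
each degree the counts satisfy `B ≤ B₀ ≤ Bq`, and also `Bq ≤ B` in degrees up to `D` when `q` avoids
the multiplier. Thus `Bq` and `B₀` have equal counts up to `D`, hence in all degrees. -/
theorem exists_fg_le_and_forall_prime [IsDomain R] [Finite σ] (p : Ideal R) [p.IsPrime]
    (hp : ∀ x y : R, ∃ a ∉ p, x ∣ a * y ∨ y ∣ a * x)
    {I : Ideal (MvPolynomial σ R)} (hI : ∀ x ∈ I, ∀ e, homogeneousComponent e x ∈ I)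
    (hsat : ∀ (r : R) (x), r ≠ 0 → r • x ∈ I → x ∈ I) :
    ∃ I' ≤ I, I'.FG ∧ ∃ a ∉ p, ∀ (q : Ideal R) [q.IsPrime], a ∉ q →
      ∀ x ∈ I, ∃ b ∉ q, b • x ∈ I' := by
  classical
  obtain ⟨I', hle, hfg, hI', hmap⟩ :=
    exists_fg_homogeneous_le_map_eq (algebraMap R p.ResidueField) hI
  obtain ⟨F, hF, hcompl⟩ := exists_finite_isCompl.{_, _, u} I' hfg
  obtain ⟨B, -, hB⟩ := hcompl (algebraMap R p.ResidueField)
  let deg (B : Set (σ →₀ ℕ)) (e : ℕ) : Set (σ →₀ ℕ) := {b ∈ B | b.degree = e}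
  have hfin (B e) : (deg B e).Finite :=
    (Finsupp.finite_of_degree_eq e).subset fun _ h => h.2
  have hsub (B e) : deg B e ⊆ B := fun _ h => h.1
  have hnak := exists_smul_monomial_mem_sup p (algebraMap R p.ResidueField)
    p.ker_algebraMap_residueField p.exists_algebraMap_residueField_mul_eq hI' hB.sup_eq_top
  choose a ha haB using hnak
  have hdisj : Disjoint (I.restrictScalars R) (restrictSupport R B) :=
    disjoint_restrictSupport_of_forall_dvd p hp (algebraMap R p.ResidueField)
      p.ker_algebraMap_residueField hsat (hmap ▸ hB.disjoint)
  -- `D` depends only on the finite family `F`, so a finite product of the multipliers `a e`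
  -- controls all degrees.
  obtain ⟨D, hD⟩ := hF.exists_bound_forall_eq fun B e => (deg B e).ncard
  refine ⟨I', hle, hfg, ∏ e ∈ Finset.range (D + 1), a e, fun h => ?_, fun q _ haq => ?_⟩
  · obtain ⟨e, -, he⟩ := (Ideal.IsPrime.prod_mem_iff (hp := ‹p.IsPrime›)).mp h
    exact ha e he
  have haq' : ∀ e ≤ D, a e ∉ q := fun e he h => haq
    (q.mem_of_dvd (Finset.dvd_prod_of_mem a (Finset.mem_range.mpr (by omega))) h)
  let K := (⊥ : Ideal R).ResidueField
  have hKker : RingHom.ker (algebraMap R K) = ⊥ := Ideal.ker_algebraMap_residueField _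
  have hKinj : Function.Injective (algebraMap R K) :=
    (RingHom.injective_iff_ker_eq_bot _).mpr hKker
  have hKne {a : R} {q : Ideal R} (h : a ∉ q) : algebraMap R K a ≠ 0 := fun h0 =>
    h ((hKinj (h0.trans (map_zero _).symm)) ▸ q.zero_mem)
  have hdisjK : Disjoint ((I'.map (map (algebraMap R K))).restrictScalars K)
      (restrictSupport K B) :=
    disjoint_map_restrictSupport_of_injective _ hKinj
      (Ideal.exists_algebraMap_residueField_mul_eq _) (hdisj.mono_left hle)
  obtain ⟨B₀, hB₀F, hB₀⟩ := hcompl (algebraMap R K)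
  obtain ⟨Bq, hBqF, hBq⟩ := hcompl (algebraMap R q.ResidueField)
  have hIK := homogeneousComponent_mem_map (algebraMap R K) hI'
  have hle₀ (e : ℕ) : (deg B e).ncard ≤ (deg B₀ e).ncard :=
    (ncard_le_and_disjoint_of_le_sup (hfin _ _) (hfin _ _)
      (hdisjK.mono_right (restrictSupport_mono _ (hsub _ _)))
      (restrictSupport_le_sup_of_sup_eq_top hIK hB₀.sup_eq_top e)).1
  have hnakq := exists_smul_monomial_mem_sup q (algebraMap R q.ResidueField)
    q.ker_algebraMap_residueField q.exists_algebraMap_residueField_mul_eq hI' hBq.sup_eq_top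
  choose c hc hcB using hnakq
  have hcmp (e : ℕ) := ncard_le_and_disjoint_of_le_sup (hfin _ _) (hfin _ _)
    (hB₀.disjoint.mono_right (restrictSupport_mono _ (hsub B₀ e)))
    (restrictSupport_le_sup_map (algebraMap R K) (hKne (hc e)) (hcB e))
  have hleq (e : ℕ) (he : e ≤ D) : (deg Bq e).ncard ≤ (deg B e).ncard :=
    (ncard_le_and_disjoint_of_le_sup (hfin _ _) (hfin _ _)
      (hBq.disjoint.mono_right (restrictSupport_mono _ (hsub Bq e)))
      (restrictSupport_le_sup_map (algebraMap R q.ResidueField)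
        (fun h => haq' e he (by rwa [← q.ker_algebraMap_residueField])) (haB e))).1
  have heq : ∀ e, (deg Bq e).ncard = (deg B₀ e).ncard := hD Bq hBqF B₀ hB₀F fun e he =>
    le_antisymm ((hleq e he).trans (hle₀ e)) (hcmp e).1
  refine exists_smul_mem_of_isHomogeneous hI q fun e x hx hxe => ⟨c e, hc e, ?_⟩
  obtain ⟨y, hy, z, hz, hyz⟩ := Submodule.mem_sup.mp (smul_mem_of_isHomogeneous (hcB e) hxe)
  have hzI : z ∈ I := by
    rw [eq_sub_of_add_eq' hyz]
    exact I.sub_mem (Submodule.smul_of_tower_mem I _ hx) (hle hy)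
  have hz0 : z = 0 := by
    have hze : z.IsHomogeneous e := by
      intro m hm
      rw [← (hz (mem_support_iff.mpr hm)).2, Finsupp.degree_eq_weight_one]
      rfl
    -- For `e > D` the multiplier `a e` may lie in `q`, but it is nonzero in `K`, which suffices to
    -- put `z` in the extension of `I'` to `K`.
    obtain ⟨y', hy', z', hz', e'⟩ := Submodule.mem_sup.mp
      (smul_mem_of_isHomogeneous (haB e) hze)
    have hz'0 : z' = 0 := by
      refine Submodule.disjoint_def.mp hdisj z' ?_
        (restrictSupport_mono _ (hsub B e) hz')
      rw [eq_sub_of_add_eq' e']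
      exact I.sub_mem (Submodule.smul_of_tower_mem I _ hzI) (hle hy')
    rw [hz'0, add_zero] at e'
    have h0 := Submodule.disjoint_def.mp ((hcmp e).2 (heq e).le) (map (algebraMap R K) z) (by
        rw [← Submodule.smul_mem_iff _ (hKne (ha e))]
        have : algebraMap R K (a e) • map (algebraMap R K) z =
            map (algebraMap R K) y' := by
          rw [e', smul_eq_C_mul, smul_eq_C_mul, map_mul, map_C]
        rw [this]
        exact Ideal.mem_map_of_mem _ hy') (by
        rw [mem_restrictSupport_iff] at hz ⊢
        exact (Finset.coe_subset.mpr (support_map_subset _ z)).trans hz)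
    exact map_injective _ hKinj (h0.trans (map_zero _).symm)
  rw [← hyz, hz0, add_zero]
  exact hy

/-- The multipliers at all primes generate the unit ideal, so finitely many suffice, and the sum of
the corresponding ideals `I' p` is locally equal to `I`. -/
theorem fg_of_homogeneous_of_saturated [IsDomain R] [Finite σ]
    (hR : ∀ (p : Ideal R) [p.IsPrime], ∀ x y : R, ∃ a ∉ p, x ∣ a * y ∨ y ∣ a * x)
    {I : Ideal (MvPolynomial σ R)} (hI : ∀ x ∈ I, ∀ e, homogeneousComponent e x ∈ I)
    (hsat : ∀ (r : R) (x), r ≠ 0 → r • x ∈ I → x ∈ I) : I.FG := by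
  classical
  have key := fun p : PrimeSpectrum R => exists_fg_le_and_forall_prime p.asIdeal
    (hR p.asIdeal) hI hsat
  choose I' hle hfg a ha h using key
  have hspan : Ideal.span (Set.range a) = ⊤ := by
    by_contra hne
    obtain ⟨m, hm, hm'⟩ := Ideal.exists_le_maximal _ hne
    exact ha ⟨m, hm.isPrime⟩ (hm' (Ideal.subset_span ⟨_, rfl⟩))
  obtain ⟨s, hs, hs'⟩ := (Ideal.span_eq_top_iff_finite _).mp hspan
  rw [← Set.image_univ] at hs
  obtain ⟨t, -, rfl⟩ := Finset.subset_set_image_iff.mp hs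
  have hI'' : I = ⨆ p ∈ t, I' p := by
    refine le_antisymm (fun x hx => ?_) (iSup₂_le fun p _ => hle p)
    by_contra hx'
    -- `𝔟` consists of the scalars carrying `x` into the sum; it lies in no maximal ideal.
    let 𝔟 : Ideal R := ((⨆ p ∈ t, I' p).restrictScalars R).comap (LinearMap.toSpanSingleton R _ x)
    have hb : 𝔟 ≠ ⊤ := fun h => hx' (by
      have : (1 : R) • x ∈ ⨆ p ∈ t, I' p := (h ▸ Submodule.mem_top : (1 : R) ∈ 𝔟)
      rwa [one_smul] at this)
    obtain ⟨m, hm, hm'⟩ := Ideal.exists_le_maximal _ hb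
    have : ∃ p ∈ t, a p ∉ m := by
      by_contra! hall
      apply hm.ne_top
      rw [eq_top_iff, ← hs']
      refine Ideal.span_le.mpr ?_
      intro y hy
      obtain ⟨p, hp, rfl⟩ := Finset.mem_image.mp hy
      exact hall p hp
    obtain ⟨p, hpt, hpm⟩ := this
    have := hm.isPrime
    obtain ⟨b, hb, hb'⟩ := h p m hpm x hx
    exact hb (hm' (show b • x ∈ ⨆ p ∈ t, I' p from le_iSup₂ (f := fun p _ => I' p) p hpt hb'))
  rw [hI'']
  exact Submodule.fg_biSup t _ fun p _ => hfg p

end MvPolynomial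

theorem IsPruferDomain.exists_notMem_dvd_mul {R : Type u} [CommRing R] (hR : IsPruferDomain R)
    (p : Ideal R) [p.IsPrime] (x y : R) : ∃ a ∉ p, x ∣ a * y ∨ y ∣ a * x := by
  have := hR.isDomain
  obtain ⟨_, _⟩ := hR.valuationRing_localization p
  have key : ∀ x y : R, algebraMap R (Localization.AtPrime p) x ∣ algebraMap R _ y →
      ∃ a ∉ p, x ∣ a * y := by
    rintro x y ⟨c, hc⟩
    obtain ⟨⟨r, s⟩, hrs⟩ := IsLocalization.surj p.primeCompl c
    refine ⟨s, s.2, r, ?_⟩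
    apply IsLocalization.injective (Localization.AtPrime p) p.primeCompl_le_nonZeroDivisors
    rw [map_mul, map_mul, hc, ← hrs]
    ring
  rcases ValuationRing.dvd_total (algebraMap R (Localization.AtPrime p) x)
    (algebraMap R (Localization.AtPrime p) y) with h | h
  · obtain ⟨a, ha, h⟩ := key _ _ h
    exact ⟨a, ha, Or.inl h⟩
  · obtain ⟨a, ha, h⟩ := key _ _ h
    exact ⟨a, ha, Or.inr h⟩

/-! ### Homogenisation: kernels of maps to torsion-free algebras -/

namespace MvPolynomial

theorem IsHomogeneous.aeval_mul_right {σ R S : Type*} [CommRing R] [CommRing S] [Algebra R S]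
    {p : MvPolynomial σ R} {e : ℕ} (hp : p.IsHomogeneous e) (f : σ → S) (t : S) :
    MvPolynomial.aeval (fun i => f i * t) p = MvPolynomial.aeval f p * t ^ e := by
  conv_lhs => rw [p.as_sum]
  conv_rhs => rw [p.as_sum]
  rw [map_sum, map_sum, Finset.sum_mul]
  refine Finset.sum_congr rfl fun m hm => ?_
  have hm' : m.degree = e := by
    by_contra hne
    exact (mem_support_iff.mp hm) (hp.coeff_eq_zero hne)
  rw [aeval_monomial, aeval_monomial, mul_assoc, ← show ∑ i ∈ m.support, m i = e from hm',
    Finsupp.prod,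
    Finsupp.prod,
    ← Finset.prod_pow_eq_pow_sum, ← Finset.prod_mul_distrib]
  simp only [mul_pow]

/-- `Φ` sends the extra variable to `T` and each other variable to its image under `h` times `T`.
Its kernel is homogeneous by the grading in `T`, saturated because `S` is torsion-free, and maps
onto generators of `ker h` when the extra variable is set to `1` by `δ`. -/
theorem ker_fg_of_isPruferDomain {τ : Type*} [Finite τ] {R : Type u} [CommRing R]
    (hR : IsPruferDomain R) {S : Type*} [CommRing S] [Algebra R S]
    (hS : ∀ (r : R) (x : S), r ≠ 0 → r • x = 0 → x = 0) (h : MvPolynomial τ R →ₐ[R] S) :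
    (RingHom.ker h).FG := by
  have := hR.isDomain
  let v : Option τ → S := fun o => o.elim 1 fun j => h (X j)
  let Φ : MvPolynomial (Option τ) R →ₐ[R] Polynomial S :=
    aeval fun o => Polynomial.C (v o) * Polynomial.X
  let δ : MvPolynomial (Option τ) R →ₐ[R] MvPolynomial τ R := aeval fun o => o.elim 1 X
  have hδ : h.comp δ = aeval v := by
    ext o
    cases o <;> simp [δ, v]
  have hΦ {p : MvPolynomial (Option τ) R} {e : ℕ} (hp : p.IsHomogeneous e) :
      Φ p = Polynomial.monomial e (h (δ p)) := by
    rw [← AlgHom.comp_apply, hδ, ← Polynomial.C_mul_X_pow_eq_monomial]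
    refine (hp.aeval_mul_right (fun o => Polynomial.C (v o)) Polynomial.X).trans ?_
    congr 1
    exact (aeval_algebraMap_apply (A := S) (B := Polynomial S) v p)
  have hΦ₁ (p : MvPolynomial (Option τ) R) : (Φ p).eval 1 = h (δ p) := by
    conv_lhs => rw [← p.sum_homogeneousComponent]
    conv_rhs => rw [← p.sum_homogeneousComponent]
    rw [map_sum, map_sum, map_sum, Polynomial.eval_finsetSum]
    refine Finset.sum_congr rfl fun e _ => ?_
    rw [hΦ (homogeneousComponent_isHomogeneous e p)]
    simp
  have hfg : (RingHom.ker Φ).FG := by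
    refine fg_of_homogeneous_of_saturated hR.exists_notMem_dvd_mul ?_ ?_
    · intro x hx e
      have hce : h (δ (homogeneousComponent e x)) = 0 := by
        have h0 : (Φ x).coeff e = 0 := by rw [show Φ x = 0 from hx, Polynomial.coeff_zero]
        by_cases he : x.totalDegree < e
        · rw [homogeneousComponent_eq_zero e x he, map_zero, map_zero]
        rw [← x.sum_homogeneousComponent, map_sum, Polynomial.finsetSum_coeff,
          Finset.sum_eq_single e] at h0
        · rw [hΦ (homogeneousComponent_isHomogeneous e x), Polynomial.coeff_monomial,
            if_pos rfl] at h0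
          exact h0
        · intro i _ hi
          rw [hΦ (homogeneousComponent_isHomogeneous i x), Polynomial.coeff_monomial, if_neg hi]
        · intro hi
          exact absurd (Finset.mem_range.mpr (by omega)) hi
      change Φ _ = 0
      rw [hΦ (homogeneousComponent_isHomogeneous e x), hce, map_zero]
    · intro r x hr hx
      change Φ x = 0
      have hx' : r • Φ x = 0 := by rw [← map_smul]; exact hx
      ext i
      refine hS r _ hr ?_
      rw [← Polynomial.coeff_smul, hx', Polynomial.coeff_zero]
  have hker : RingHom.ker h = (RingHom.ker Φ).map δ := by
    apply le_antisymm
    · intro g hg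
      let d := g.totalDegree
      -- `G` is the homogenisation of `g`; the subtraction is never truncated since `i ≤ d`.
      let G : MvPolynomial (Option τ) R := ∑ i ∈ Finset.range (d + 1),
        X none ^ (d - i) * rename some (homogeneousComponent i g)
      have hG : G.IsHomogeneous d := by
        refine IsHomogeneous.sum _ _ _ fun i hi => ?_
        have hi' : d = (d - i) + i := by have := Finset.mem_range.mp hi; omega
        nth_rewrite 2 [hi']
        exact (isHomogeneous_X_pow _ _).mul
          ((homogeneousComponent_isHomogeneous i g).rename_isHomogeneous)
      have hδG : δ G = g := by
        conv_rhs => rw [← g.sum_homogeneousComponent]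
        rw [map_sum]
        refine Finset.sum_congr rfl fun i _ => ?_
        rw [map_mul, map_pow, aeval_X, Option.elim_none, one_pow, one_mul, aeval_rename]
        exact aeval_X_left_apply _
      rw [← hδG]
      refine Ideal.mem_map_of_mem _ ?_
      change Φ G = 0
      rw [hΦ hG, hδG, show h g = 0 from hg, map_zero]
    · rw [Ideal.map_le_iff_le_comap]
      intro x hx
      change h (δ x) = 0
      rw [← hΦ₁, show Φ x = 0 from hx, Polynomial.eval_zero]
  rw [hker]
  exact hfg.map _

end MvPolynomial

/-! ### Finitely generated syzygies -/

/-- Every finite family of elements of `A` has a finitely generated module of linear relations. -/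
def HasFGSyzygies (A : Type*) [CommRing A] : Prop :=
  ∀ (n : ℕ) (s : Fin n → A), (LinearMap.ker (Fintype.linearCombination A s)).FG

namespace HasFGSyzygies

variable {A : Type*} [CommRing A]

theorem ker_fg (hA : HasFGSyzygies A) {ι : Type*} [Fintype ι] (s : ι → A) :
    (LinearMap.ker (Fintype.linearCombination A s)).FG := by
  let e := Fintype.equivFin ι
  have h := (hA _ (s ∘ e.symm)).map (LinearEquiv.funCongrLeft A A e).toLinearMap
  convert h
  ext c
  simp only [Submodule.mem_map, LinearMap.mem_ker, Fintype.linearCombination_apply]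
  constructor
  · intro hc
    refine ⟨c ∘ e.symm, ?_, ?_⟩
    · rw [← hc]
      exact e.symm.sum_comp fun i => c i • s i
    · ext i
      simp [LinearEquiv.funCongrLeft]
  · rintro ⟨c, hc, rfl⟩
    rw [← hc]
    refine Fintype.sum_equiv e _ _ fun i => ?_
    simp [LinearEquiv.funCongrLeft]

theorem finitePresentation_ideal (hA : HasFGSyzygies A) {J : Ideal A} (hJ : J.FG) :
    Module.FinitePresentation A J := by
  obtain ⟨n, s, hs⟩ := Submodule.fg_iff_exists_fin_generating_family.mp hJ
  have hrange : LinearMap.range (Fintype.linearCombination A s) = J := by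
    rw [Fintype.range_linearCombination, hs]
  let l : (Fin n → A) →ₗ[A] J := (Fintype.linearCombination A s).codRestrict J fun c =>
    hrange ▸ LinearMap.mem_range_self _ c
  refine Module.finitePresentation_of_surjective l ?_ ?_
  · rintro ⟨x, hx⟩
    rw [← hrange] at hx
    obtain ⟨c, rfl⟩ := hx
    exact ⟨c, rfl⟩
  · rw [LinearMap.ker_codRestrict]
    exact hA n s

/-- Lift the family to `A` and append generators of the kernel: relations over `B` are the
projections of relations of the enlarged family. -/
theorem of_surjective {B : Type*} [CommRing B] (hA : HasFGSyzygies A) (f : A →+* B)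
    (hf : Function.Surjective f) (hker : (RingHom.ker f).FG) : HasFGSyzygies B := by
  intro n s
  let := f.toAlgebra
  obtain ⟨r, k, hk⟩ := Submodule.fg_iff_exists_fin_generating_family.mp hker
  choose g hg using hf
  let t : Fin n ⊕ Fin r → A := Sum.elim (g ∘ s) k
  let p : (Fin n ⊕ Fin r → A) →ₗ[A] (Fin n → B) :=
    LinearMap.pi fun i => (Algebra.linearMap A B) ∘ₗ LinearMap.proj (Sum.inl i)
  have hp (c i) : p c i = f (c (Sum.inl i)) := rfl
  have hmap : (LinearMap.ker (Fintype.linearCombination A t)).map p =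
      (LinearMap.ker (Fintype.linearCombination B s)).restrictScalars A := by
    ext b
    simp only [Submodule.mem_map, LinearMap.mem_ker, Fintype.linearCombination_apply,
      Submodule.restrictScalars_mem, Fintype.sum_sum_type, t, Sum.elim_inl, Sum.elim_inr,
      Function.comp_apply, smul_eq_mul]
    constructor
    · rintro ⟨c, hc, rfl⟩
      have hkf : ∀ j, f (k j) = 0 := fun j => by
        have : k j ∈ RingHom.ker f := hk ▸ Submodule.subset_span ⟨j, rfl⟩
        exact this
      have := congrArg f hc
      simpa [hg, hkf, map_sum, hp] using this
    · intro hb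
      have h0 : -∑ i, g (b i) * g (s i) ∈ RingHom.ker f := by
        rw [RingHom.mem_ker]
        simp [map_sum, hg, hb]
      rw [← hk, ← Fintype.range_linearCombination (R := A)] at h0
      obtain ⟨d, hd⟩ := h0
      refine ⟨Sum.elim (g ∘ b) d, ?_, ?_⟩
      · rw [Fintype.linearCombination_apply] at hd
        simp only [smul_eq_mul] at hd
        simp [hd]
      · ext i
        rw [hp]
        exact hg _
  have := (hA.ker_fg t).map p
  rw [hmap] at this
  exact this.of_restrictScalars

/-- The map `L` given by `s` induces an algebra map `Λ` of square-zero extensions whose kernel is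
`ker L` in the square-zero part. The source is a quotient of a polynomial ring over `R` and the
target is torsion-free, so the kernel theorem for algebra maps applies. -/
theorem mvPolynomial {σ : Type*} [Finite σ] {R : Type u} [CommRing R] (hR : IsPruferDomain R) :
    HasFGSyzygies (MvPolynomial σ R) := by
  intro n s
  let D := MvPolynomial σ R
  let L : (Fin n → D) →ₗ[D] D := Fintype.linearCombination D s
  let Ψ : MvPolynomial (σ ⊕ Fin n) R →ₐ[R] TrivSqZeroExt D (Fin n → D) :=
    MvPolynomial.aeval (Sum.elim (fun i => TrivSqZeroExt.inl (MvPolynomial.X i))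
      fun j => TrivSqZeroExt.inr (Pi.single j 1))
  let Λ : TrivSqZeroExt D (Fin n → D) →ₐ[R] TrivSqZeroExt D D :=
    (TrivSqZeroExt.map L).restrictScalars R
  have hΨ : Function.Surjective Ψ := by
    rw [← AlgHom.range_eq_top, eq_top_iff]
    have h1 : ∀ d : D, TrivSqZeroExt.inl d ∈ Ψ.range := by
      intro d
      refine ⟨MvPolynomial.rename Sum.inl d, ?_⟩
      change Ψ _ = _
      rw [MvPolynomial.aeval_rename]
      have : (TrivSqZeroExt.inlAlgHom R D (Fin n → D)) =
          MvPolynomial.aeval (fun i => TrivSqZeroExt.inl (MvPolynomial.X i)) := by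
        refine MvPolynomial.algHom_ext fun i => ?_
        rw [MvPolynomial.aeval_X]
        rfl
      exact (congrArg (fun φ => φ d) this).symm
    have h2 : ∀ c : Fin n → D, TrivSqZeroExt.inr c ∈ Ψ.range := by
      intro c
      have : (TrivSqZeroExt.inr c : TrivSqZeroExt D (Fin n → D)) =
          ∑ j, TrivSqZeroExt.inl (c j) * TrivSqZeroExt.inr (Pi.single j 1) := by
        refine Eq.trans ?_ (Finset.sum_congr rfl fun j _ => (TrivSqZeroExt.inl_mul_inr ..).symm)
        rw [← TrivSqZeroExt.inr_sum]
        congr 1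
        exact pi_eq_sum_univ' c
      rw [this]
      refine sum_mem fun j _ => mul_mem (h1 _) ⟨MvPolynomial.X (Sum.inr j), ?_⟩
      exact MvPolynomial.aeval_X _ _
    intro x _
    rw [← TrivSqZeroExt.inl_fst_add_inr_snd_eq x]
    exact add_mem (h1 _) (h2 _)
  have hfg : (RingHom.ker (Λ.comp Ψ)).FG := by
    refine MvPolynomial.ker_fg_of_isPruferDomain hR ?_ _
    have := hR.isDomain
    intro r x hr hx
    ext1
    · exact (smul_eq_zero.mp (congrArg TrivSqZeroExt.fst hx)).resolve_left hr
    · exact (smul_eq_zero.mp (congrArg TrivSqZeroExt.snd hx)).resolve_left hr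
  have hmap : (RingHom.ker (Λ.comp Ψ)).map Ψ = RingHom.ker Λ := by
    have : RingHom.ker (Λ.comp Ψ) = (RingHom.ker Λ).comap Ψ := rfl
    rw [this]
    exact Ideal.map_comap_of_surjective _ hΨ _
  have hΛ (x) : x ∈ RingHom.ker Λ ↔ x.fst = 0 ∧ L x.snd = 0 := by
    rw [RingHom.mem_ker, TrivSqZeroExt.ext_iff]
    exact Iff.of_eq (congrArg₂ _ (congrArg (· = 0) (TrivSqZeroExt.fst_map L x))
      (congrArg (· = 0) (TrivSqZeroExt.snd_map L x)))
  have hΛfg : (RingHom.ker Λ).FG := hmap ▸ hfg.map _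
  obtain ⟨S, hS⟩ := hΛfg
  classical
  -- On elements with zero first component the extension acts through `D`, so ideal generators give
  -- module generators.
  refine ⟨S.image TrivSqZeroExt.snd, le_antisymm ?_ ?_⟩
  · rw [Submodule.span_le]
    intro y hy
    obtain ⟨x, hx, rfl⟩ := Finset.mem_image.mp hy
    have : x ∈ RingHom.ker Λ := hS ▸ Submodule.subset_span hx
    exact ((hΛ x).mp this).2
  · intro c hc
    have hcS : TrivSqZeroExt.inr c ∈ RingHom.ker Λ := (hΛ _).mpr ⟨rfl, hc⟩
    rw [← hS] at hcS
    suffices ∀ x ∈ Ideal.span (S : Set (TrivSqZeroExt D (Fin n → D))), x.fst = 0 ∧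
        x.snd ∈ Submodule.span D (S.image TrivSqZeroExt.snd : Set (Fin n → D)) from
      (this _ hcS).2
    intro x hx
    refine Submodule.span_induction (p := fun x _ => x.fst = 0 ∧
      x.snd ∈ Submodule.span D (S.image TrivSqZeroExt.snd : Set (Fin n → D))) ?_ ?_ ?_ ?_ hx
    · intro x hx
      refine ⟨((hΛ x).mp (hS ▸ Submodule.subset_span hx)).1,
        Submodule.subset_span (Finset.mem_image_of_mem _ hx)⟩
    · exact ⟨rfl, Submodule.zero_mem _⟩
    · rintro x y _ _ ⟨h1, h2⟩ ⟨h3, h4⟩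
      exact ⟨by rw [TrivSqZeroExt.fst_add, h1, h3, add_zero], add_mem h2 h4⟩
    · rintro a x _ ⟨h1, h2⟩
      refine ⟨by rw [smul_eq_mul, TrivSqZeroExt.fst_mul, h1, mul_zero], ?_⟩
      rw [smul_eq_mul, TrivSqZeroExt.snd_mul, h1]
      simpa using Submodule.smul_mem _ _ h2

end HasFGSyzygies

/-! ### Finitely presented algebras over Prüfer rings -/

namespace HasFGSyzygies

theorem of_finitePresentation {R : Type u} [CommRing R] (hR : IsPruferDomain R) (A : Type*)
    [CommRing A] [Algebra R A] [Algebra.FinitePresentation R A] : HasFGSyzygies A := by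
  obtain ⟨n, f, hf, hker⟩ := Algebra.FinitePresentation.out (R := R) (A := A)
  exact (mvPolynomial hR (σ := Fin n)).of_surjective f.toRingHom hf hker

/-- Since `e i` kills the kernel of `f i`, lifts of relations over `B i` become relations over `A`
after multiplication by `e i`; summing over `i` recovers every relation. -/
theorem of_finite_family {A ι : Type*} [CommRing A] [Fintype ι] {B : ι → Type*}
    [∀ i, CommRing (B i)] (f : ∀ i, A →+* B i) (hf : ∀ i, Function.Surjective (f i)) (e : ι → A)
    (he : ∑ i, e i = 1) (hfe : ∀ i x, f i x = 0 → e i * x = 0) (h : ∀ i, HasFGSyzygies (B i)) :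
    HasFGSyzygies A := by
  intro n s
  choose g hg using hf
  choose m c hc using fun i => Submodule.fg_iff_exists_fin_generating_family.mp (h i n (f i ∘ s))
  let y (i : ι) (j : Fin (m i)) (l : Fin n) : A := e i * g i (c i j l)
  refine Submodule.fg_iff_exists_finite_generating_family.mpr
    ⟨Σ i, Fin (m i), inferInstance, fun x => y x.1 x.2, le_antisymm ?_ ?_⟩
  · rw [Submodule.span_le]
    rintro _ ⟨⟨i, j⟩, rfl⟩
    have h1 : c i j ∈ LinearMap.ker (Fintype.linearCombination (B i) (f i ∘ s)) :=
      hc i ▸ Submodule.subset_span ⟨j, rfl⟩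
    have h2 := hfe i (∑ l, g i (c i j l) * s l) (by
      simpa [Fintype.linearCombination_apply, hg, map_sum] using h1)
    change Fintype.linearCombination A s (y i j) = 0
    simpa [Fintype.linearCombination_apply, y, Finset.mul_sum, mul_assoc] using h2
  · intro x hx
    have hx' : x = ∑ i, e i • x := by rw [← Finset.sum_smul, he, one_smul]
    rw [hx']
    refine Submodule.sum_mem _ fun i _ => ?_
    have h1 : f i ∘ x ∈ LinearMap.ker (Fintype.linearCombination (B i) (f i ∘ s)) := by
      have := congrArg (f i) (show Fintype.linearCombination A s x = 0 from hx)
      simpa [Fintype.linearCombination_apply, map_sum] using this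
    rw [← hc i, ← Fintype.range_linearCombination (R := B i)] at h1
    obtain ⟨a, ha⟩ := h1
    have h2 : e i • x = ∑ j, g i (a j) • y i j := by
      ext l
      have h3 := hfe i (x l - ∑ j, g i (a j) * g i (c i j l)) (by
        have := congrFun ha l
        simp only [Fintype.linearCombination_apply, Finset.sum_apply, Pi.smul_apply,
          smul_eq_mul, Function.comp_apply] at this
        simp [map_sum, hg, this])
      rw [mul_sub, sub_eq_zero] at h3
      simp only [Pi.smul_apply, Finset.sum_apply, smul_eq_mul, y]
      rw [h3, Finset.mul_sum]
      exact Finset.sum_congr rfl fun j _ => by ring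
    rw [h2]
    exact Submodule.sum_mem _ fun j _ =>
      Submodule.smul_mem _ _ (Submodule.subset_span ⟨⟨i, j⟩, rfl⟩)

theorem of_isPruferRing {R : Type u} [CommRing R] (hR : IsPruferRing R) (A : Type u)
    [CommRing A] [Algebra R A] [Algebra.FinitePresentation R A] : HasFGSyzygies A := by
  obtain ⟨n, D, _, hD, ⟨φ⟩⟩ := hR
  let _ (i) : Algebra R (D i) := ((Pi.evalRingHom D i).comp φ.toRingHom).toAlgebra
  have hmap (i) (r : R) : algebraMap R (D i) r = φ r i := rfl
  have hsurj (i) : Function.Surjective (algebraMap R (D i)) := fun d =>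
    ⟨φ.symm (Pi.single i d), by rw [hmap, φ.apply_symm_apply, Pi.single_eq_same]⟩
  refine of_finite_family (B := fun i => TensorProduct R (D i) A)
    (fun i => (Algebra.TensorProduct.includeRight : A →ₐ[R] TensorProduct R (D i) A).toRingHom)
    (fun i => Algebra.TensorProduct.includeRight_surjective _ (hsurj i))
    (fun i => algebraMap R A (φ.symm (Pi.single i 1))) ?_ ?_
    (fun i => of_finitePresentation (hD i) _)
  · have h1 : ∑ i, Pi.single i (1 : D i) = (1 : ∀ i, D i) :=
      Finset.univ_sum_single (1 : ∀ i, D i)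
    rw [← map_sum, ← map_sum, h1, map_one, map_one]
  · intro i x hx
    -- The inclusion of the `i`-th factor is `R`-linear; tensored with `A` it sends `1 ⊗ x` to the
    -- idempotent times `x`.
    let ρ : D i →ₗ[R] R :=
      { toFun := fun d => φ.symm (Pi.single i d)
        map_add' := fun d d' => by rw [Pi.single_add, map_add]
        map_smul' := fun r d => by
          apply φ.injective
          rw [RingHom.id_apply, smul_eq_mul, map_mul, φ.apply_symm_apply, φ.apply_symm_apply,
            Algebra.smul_def, hmap]
          ext j
          by_cases hj : j = i
          · subst hj; simp
          · simp [hj] }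
    have := congrArg (fun t => TensorProduct.lid R A (LinearMap.rTensor A ρ t))
      (show (1 : D i) ⊗ₜ[R] x = 0 from hx)
    simpa [ρ, Algebra.smul_def] using this

end HasFGSyzygies

/-! ### Finite type criteria for sheaves of modules -/

namespace SheafOfModules

universe v' u'

variable {C : Type u'} [Category.{v'} C] {J : GrothendieckTopology C} {R : Sheaf J RingCat.{u}}

theorem presheaf_map_comp_apply (M : SheafOfModules.{u} R) {X Y Z : C} (f : Z ⟶ Y) (g : Y ⟶ X)
    (m : M.val.obj (.op X)) :
    (M.val.presheaf.map f.op (M.val.presheaf.map g.op m : M.val.obj (.op Y)) :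
      M.val.obj (.op Z)) = M.val.presheaf.map (f ≫ g).op m := by
  rw [op_comp, Functor.map_comp]
  rfl

/-- Two morphisms out of `M` that agree on the sections agree on their local spans, hence everywhere
because the target is separated. -/
theorem epi_freeHomEquiv_symm_of_locally_mem_span [HasWeakSheafify J AddCommGrpCat.{u}]
    [J.WEqualsLocallyBijective AddCommGrpCat.{u}] (M : SheafOfModules.{u} R) {I : Type u}
    (s : I → M.sections)
    (h : ∀ (U : C) (m : M.val.obj (.op U)), ∃ S ∈ J U, ∀ ⦃V : C⦄ (f : V ⟶ U), S f →
      M.val.presheaf.map f.op m ∈ Submodule.span (R.obj.obj (.op V))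
        (Set.range fun i => (s i).eval (.op V))) :
    Epi (M.freeHomEquiv.symm s) := by
  refine ⟨fun {P} a b hab => ?_⟩
  have hs (i : I) : sectionsMap a (s i) = sectionsMap b (s i) := by
    rw [freeHomEquiv_symm_comp, freeHomEquiv_symm_comp] at hab
    exact congrFun (P.freeHomEquiv.symm.injective hab) i
  ext U m
  obtain ⟨S, hS, hm⟩ := h U.unop m
  refine (isSheaf P).isSeparated _ S hS _ _ fun V f hf => ?_
  have h1 := hm f hf
  have h2 : Submodule.span (R.obj.obj (.op V)) (Set.range fun i => (s i).eval (.op V)) ≤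
      LinearMap.eqLocus (a.val.app (.op V)).hom (b.val.app (.op V)).hom := by
    rw [Submodule.span_le]
    rintro _ ⟨i, rfl⟩
    exact congrArg (fun t => PresheafOfModules.sections.eval t (.op V)) (hs i)
  have h3 := h2 h1
  exact (PresheafOfModules.naturality_apply a.val f.op m).symm.trans
    (h3.trans (PresheafOfModules.naturality_apply b.val f.op m))

/-- The section over `X` defined by an element of `M(X)`. -/
noncomputable def overSection (M : SheafOfModules.{u} R) {X : C} (m : M.val.obj (.op X)) :
    (M.over X).sections :=
  PresheafOfModules.sectionsMk (fun Y => M.val.presheaf.map Y.unop.hom.op m) fun Y Z f =>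
    (presheaf_map_comp_apply M f.unop.left Y.unop.hom m).trans (by rw [Over.w])

theorem isFiniteType_of_locally_mem_span
    [∀ X : C, HasWeakSheafify (J.over X) AddCommGrpCat.{u}]
    [∀ X : C, (J.over X).WEqualsLocallyBijective AddCommGrpCat.{u}]
    (M : SheafOfModules.{u} R) {ι : Type u'} (X : ι → C) (hX : J.CoversTop X)
    (h : ∀ i, ∃ (n : ℕ) (t : Fin n → M.val.obj (.op (X i))),
      ∀ (U : C) (f : U ⟶ X i) (m : M.val.obj (.op U)), ∃ S ∈ J U, ∀ ⦃V : C⦄ (g : V ⟶ U), S g →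
        M.val.presheaf.map g.op m ∈ Submodule.span (R.obj.obj (.op V))
          (Set.range fun j => (M.val.presheaf.map (g ≫ f).op (t j) : M.val.obj (.op V)))) :
    IsFiniteType.{u} M := by
  choose n t h using h
  refine ⟨⟨⟨ι, X, hX, fun i => ⟨ULift (Fin (n i)), fun j => overSection M (t i j.down),
    epi_freeHomEquiv_symm_of_locally_mem_span _ _ fun U m => ?_⟩⟩,
    ⟨fun i => ⟨(inferInstance : Finite (ULift (Fin (n i))))⟩⟩⟩⟩
  obtain ⟨S, hS, hm⟩ := h i U.left U.hom m
  refine ⟨(Sieve.overEquiv U).symm S, J.overEquiv_symm_mem_over _ _ hS, fun V g hg => ?_⟩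
  have h1 := hm g.left ((Sieve.overEquiv_symm_iff _ g).mp hg)
  refine Submodule.span_mono (R := R.obj.obj (.op V.left)) (M := M.val.obj (.op V.left)) ?_ h1
  rintro _ ⟨j, rfl⟩
  refine ⟨⟨j⟩, ?_⟩
  change M.val.presheaf.map V.hom.op (t i j) = _
  rw [Over.w]

theorem sum_val_app {M N : SheafOfModules.{u} R} {ι : Type*} (s : Finset ι) (f : ι → (M ⟶ N))
    (X : C) (m : M.val.obj (.op X)) :
    (∑ i ∈ s, f i).val.app (.op X) m = ∑ i ∈ s, (f i).val.app (.op X) m := by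
  classical
  induction s using Finset.induction_on with
  | empty => simp only [Finset.sum_empty]; rfl
  | insert a s ha ih =>
    rw [Finset.sum_insert ha, Finset.sum_insert ha, ← ih]
    rfl

theorem kernel_ι_val_app_injective {M N : SheafOfModules.{u} R} (φ : M ⟶ N) (X : C) :
    Function.Injective ((kernel.ι φ).val.app (.op X)) := by
  have : Mono ((evaluation R (.op X)).map (kernel.ι φ)) := inferInstance
  exact (ModuleCat.mono_iff_injective _).mp this

variable [HasSheafify J AddCommGrpCat.{u}] [J.WEqualsLocallyBijective AddCommGrpCat.{u}]

theorem exists_kernel_ι_val_app_eq {M N : SheafOfModules.{u} R} (φ : M ⟶ N) {X : C}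
    (m : M.val.obj (.op X)) (hm : φ.val.app (.op X) m = 0) :
    ∃ k, (kernel.ι φ).val.app (.op X) k = m := by
  have h := isLimitForkMapOfIsLimit' (evaluation R (.op X)) (kernel.condition φ)
    (kernelIsKernel φ)
  let S : ShortComplex (ModuleCat (R.obj.obj (.op X))) := ShortComplex.mk
    ((evaluation R (.op X)).map (kernel.ι φ)) ((evaluation R (.op X)).map φ) (by
      rw [← Functor.map_comp, kernel.condition, Functor.map_zero])
  have hS : S.Exact := S.exact_of_f_is_kernel h
  exact (ShortComplex.moduleCat_exact_iff S).mp hS m hm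

/-- The `i`-th coordinate of a free module. -/
noncomputable def freeProj {I : Type u} [DecidableEq I] (i : I) : free (R := R) I ⟶ unit R :=
  Cofan.IsColimit.desc (isColimitFreeCofan I) fun j => if j = i then 𝟙 _ else 0

theorem ιFree_freeProj {I : Type u} [DecidableEq I] (i j : I) :
    ιFree (R := R) j ≫ freeProj i = if j = i then 𝟙 _ else 0 :=
  Cofan.IsColimit.fac (isColimitFreeCofan I) _ j

theorem sum_freeProj_comp_ιFree {I : Type u} [Fintype I] [DecidableEq I] :
    ∑ i, freeProj i ≫ ιFree i = 𝟙 (free (R := R) I) := by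
  refine Cofan.IsColimit.hom_ext (isColimitFreeCofan I) _ _ fun j => ?_
  change ιFree j ≫ _ = ιFree j ≫ _
  rw [Preadditive.comp_sum, Finset.sum_eq_single j]
  · rw [← Category.assoc, ιFree_freeProj, if_pos rfl, Category.id_comp, Category.comp_id]
  · intro i _ hij
    rw [← Category.assoc, ιFree_freeProj, if_neg hij.symm, zero_comp]
  · simp

/-- The section `∑ i, a i • e i` of a free module over `X`. -/
noncomputable def freeMk {I : Type u} [Fintype I] {X : C} (a : I → R.obj.obj (.op X)) :
    (free (R := R) I).val.obj (.op X) :=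
  ∑ i, (ιFree i).val.app (.op X) (a i)

theorem exists_freeMk_eq {I : Type u} [Fintype I] {X : C}
    (m : (free (R := R) I).val.obj (.op X)) : ∃ a, freeMk a = m := by
  classical
  refine ⟨fun i => (freeProj i).val.app (.op X) m, ?_⟩
  have h := congrArg (fun f => f.val.app (.op X) m) (sum_freeProj_comp_ιFree (R := R) (I := I))
  rw [sum_val_app] at h
  exact h

theorem freeMk_sum_smul {I : Type u} {κ : Type*} [Fintype I] [Fintype κ] {X : C}
    (d : κ → R.obj.obj (.op X)) (c : κ → I → R.obj.obj (.op X)) :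
    freeMk (∑ j, d j • c j) = ∑ j, d j • freeMk (c j) := by
  let F (i : I) : R.obj.obj (.op X) →ₗ[R.obj.obj (.op X)] (free (R := R) I).val.obj (.op X) :=
    ((ιFree (R := R) i).val.app (.op X)).hom
  change ∑ i, F i ((∑ j, d j • c j) i) = ∑ j, d j • ∑ i, F i (c j i)
  simp only [Finset.smul_sum, Finset.sum_apply, map_sum, Pi.smul_apply, map_smul]
  exact Finset.sum_comm

theorem map_freeMk {I : Type u} [Fintype I] {X Y : C} (f : Y ⟶ X) (a : I → R.obj.obj (.op X)) :
    (free (R := R) I).val.presheaf.map f.op (freeMk a) =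
      freeMk (fun i => R.obj.map f.op (a i)) := by
  rw [freeMk, freeMk]
  refine (map_sum ((free (R := R) I).val.presheaf.map f.op).hom _ _).trans
    (Finset.sum_congr rfl fun i _ => ?_)
  exact (PresheafOfModules.naturality_apply (ιFree i).val f.op (a i)).symm

theorem freeHomEquiv_symm_val_app_freeMk {I : Type u} [Fintype I] {M : SheafOfModules.{u} R}
    (s : I → M.sections) {X : C} (a : I → R.obj.obj (.op X)) :
    (M.freeHomEquiv.symm s).val.app (.op X) (freeMk a) = ∑ i, a i • (s i).eval (.op X) := by
  rw [freeMk, map_sum]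
  refine Finset.sum_congr rfl fun i _ => ?_
  have h1 : ιFree i ≫ M.freeHomEquiv.symm s = M.unitHomEquiv.symm (s i) :=
    Cofan.IsColimit.fac (isColimitFreeCofan I) _ i
  change (ιFree i ≫ M.freeHomEquiv.symm s).val.app (.op X) (a i) = _
  rw [h1]
  rfl

/-- Reduces finite type of the kernel to elementary relations. Kernels are computed sectionwise and,
as `I` is finite, sections of the free module are tuples, so no sheafification intervenes. -/
theorem isFiniteType_kernel_freeHomEquiv_symm
    [∀ X : C, HasWeakSheafify (J.over X) AddCommGrpCat.{u}]
    [∀ X : C, (J.over X).WEqualsLocallyBijective AddCommGrpCat.{u}]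
    {M : SheafOfModules.{u} R} {I : Type u} [Fintype I] (s : I → M.sections)
    {ι : Type u'} (X : ι → C) (hX : J.CoversTop X)
    (h : ∀ i, ∃ (n : ℕ) (c : Fin n → I → R.obj.obj (.op (X i))),
      (∀ j, ∑ l, c j l • (s l).eval (.op (X i)) = 0) ∧
      ∀ (U : C) (f : U ⟶ X i) (a : I → R.obj.obj (.op U)), ∑ l, a l • (s l).eval (.op U) = 0 →
        ∃ S ∈ J U, ∀ ⦃V : C⦄ (g : V ⟶ U), S g → ∃ d : Fin n → R.obj.obj (.op V),
          (fun l => R.obj.map g.op (a l)) = ∑ j, d j • fun l => R.obj.map (g ≫ f).op (c j l)) :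
    IsFiniteType.{u} (kernel (M.freeHomEquiv.symm s)) := by
  refine isFiniteType_of_locally_mem_span _ X hX fun i => ?_
  obtain ⟨n, c, hc, h⟩ := h i
  choose t ht using fun j => exists_kernel_ι_val_app_eq (M.freeHomEquiv.symm s) (freeMk (c j))
    ((freeHomEquiv_symm_val_app_freeMk s (c j)).trans (hc j))
  refine ⟨n, t, fun U f m => ?_⟩
  obtain ⟨a, ha⟩ := exists_freeMk_eq ((kernel.ι (M.freeHomEquiv.symm s)).val.app (.op U) m)
  have ha0 : ∑ l, a l • (s l).eval (.op U) = 0 := by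
    rw [← freeHomEquiv_symm_val_app_freeMk, ha]
    exact congrArg (fun f => f.val.app (.op U) m) (kernel.condition (M.freeHomEquiv.symm s))
  obtain ⟨S, hS, h⟩ := h U f a ha0
  refine ⟨S, hS, fun V g hg => ?_⟩
  obtain ⟨d, hd⟩ := h g hg
  have key : (kernel (M.freeHomEquiv.symm s)).val.presheaf.map g.op m =
      ∑ j, d j • ((kernel (M.freeHomEquiv.symm s)).val.presheaf.map (g ≫ f).op (t j) :
        (kernel (M.freeHomEquiv.symm s)).val.obj (.op V)) := by
    refine kernel_ι_val_app_injective (M.freeHomEquiv.symm s) V ?_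
    refine Eq.trans ?_ (map_sum ((kernel.ι (M.freeHomEquiv.symm s)).val.app (.op V)).hom _ _).symm
    refine (PresheafOfModules.naturality_apply (kernel.ι (M.freeHomEquiv.symm s)).val
      g.op m).trans ?_
    rw [← ha]
    refine (map_freeMk g a).trans ?_
    rw [hd, freeMk_sum_smul]
    refine Finset.sum_congr rfl fun j _ => ?_
    refine Eq.trans ?_
      (map_smul ((kernel.ι (M.freeHomEquiv.symm s)).val.app (.op V)).hom (d j) _).symm
    refine congrArg (d j • ·) ?_
    refine (map_freeMk (g ≫ f) (c j)).symm.trans ?_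
    rw [← ht]
    exact (PresheafOfModules.naturality_apply (kernel.ι (M.freeHomEquiv.symm s)).val
      (g ≫ f).op (t j)).symm
  rw [key]
  exact Submodule.sum_mem _ fun j _ => Submodule.smul_mem _ _ (Submodule.subset_span ⟨j, rfl⟩)

end SheafOfModules

/-! ### From rings to schemes -/

/-- Exactness of localisation on elements: `m` clears the denominators of `b`, `m'` makes the
relation hold in `A`, and the product is inverted at the end. -/
theorem IsLocalization.exists_eq_sum_smul_of_span_eq_ker {A B ι κ : Type*} [CommRing A]
    [CommRing B] [Algebra A B] (M : Submonoid A) [IsLocalization M B] [Fintype ι] [Fintype κ]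
    (r : ι → A) (c : κ → ι → A)
    (hc : Submodule.span A (Set.range c) = LinearMap.ker (Fintype.linearCombination A r))
    (b : ι → B) (hb : ∑ i, b i * algebraMap A B (r i) = 0) :
    ∃ d : κ → B, b = ∑ j, d j • fun i => algebraMap A B (c j i) := by
  obtain ⟨m, hm⟩ := IsLocalization.exist_integer_multiples_of_finite M b
  choose a ha using hm
  have h0 : algebraMap A B (∑ i, a i * r i) = 0 := by
    simp only [map_sum, map_mul, ha, smul_mul_assoc, ← Finset.smul_sum, hb, smul_zero]
  obtain ⟨m', hm'⟩ := (IsLocalization.map_eq_zero_iff M B _).mp h0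
  have h1 : (m' : A) • a ∈ LinearMap.ker (Fintype.linearCombination A r) := by
    simpa [Fintype.linearCombination_apply, Finset.mul_sum, mul_assoc] using hm'
  rw [← hc, ← Fintype.range_linearCombination (R := A)] at h1
  obtain ⟨e, he⟩ := h1
  have hu := IsLocalization.map_units B (m' * m)
  refine ⟨fun j => (hu.unit⁻¹ : Bˣ) * algebraMap A B (e j), ?_⟩
  ext i
  have h2 : algebraMap A B (m' * m : M) * b i =
      ∑ j, algebraMap A B (e j) * algebraMap A B (c j i) := by
    have h3 := congrArg (algebraMap A B) (congrFun he i)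
    simp only [Fintype.linearCombination_apply, Finset.sum_apply, Pi.smul_apply, smul_eq_mul,
      map_sum, map_mul, ha] at h3
    rw [h3, Submonoid.coe_mul, map_mul, mul_assoc, ← Algebra.smul_def (m : A)]
  simp only [Finset.sum_apply, Pi.smul_apply, smul_eq_mul, mul_assoc, ← Finset.mul_sum]
  rw [← h2, ← mul_assoc, IsUnit.val_inv_mul, one_mul]

namespace AlgebraicGeometry.Scheme

open TopologicalSpace

theorem coversTop_affineOpens (X : Scheme.{u}) :
    (Opens.grothendieckTopology X).CoversTop (fun V : X.affineOpens => V.1) := by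
  intro U x hx
  obtain ⟨_, ⟨V, hV, rfl⟩, hxV, hVU⟩ := X.isBasis_affineOpens.exists_subset_of_mem_open hx U.isOpen
  exact ⟨V, homOfLE hVU, ⟨⟨V, hV⟩, ⟨𝟙 _⟩⟩, hxV⟩

/-- The isomorphism `e` allows for the restriction of the unit to an open, which is identified with
the unit only through an isomorphism. Generating relations on an affine open still generate on its
basic opens. -/
theorem Modules.isFiniteType_kernel_of_iso_unit {X : Scheme.{u}}
    (hX : ∀ V : X.affineOpens, HasFGSyzygies Γ(X, V)) {M : X.Modules}
    (e : M ≅ (SheafOfModules.unit X.ringCatSheaf : X.Modules)) {I : Type u} [Finite I]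
    (s : I → SheafOfModules.sections (R := X.ringCatSheaf) M) :
    SheafOfModules.IsFiniteType.{u} (R := X.ringCatSheaf)
      (kernel ((SheafOfModules.freeHomEquiv (R := X.ringCatSheaf) M).symm s)) := by
  have := Fintype.ofFinite I
  let σ (V : X.Opens) (l : I) : Γ(M, V) := (s l).eval (.op V)
  let r (V : X.Opens) (l : I) : Γ(X, V) := e.hom.app V (σ V l)
  have hr {V W : X.Opens} (i : V ⟶ W) (l : I) : X.presheaf.map i.op (r W l) = r V l := by
    have h1 : M.presheaf.map i.op (σ W l) = σ V l := PresheafOfModules.sections_property _ _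
    change _ = e.hom.app V (σ V l)
    rw [← h1]
    exact (PresheafOfModules.naturality_apply e.hom.val i.op (σ W l)).symm
  have hs (V : X.Opens) (a : I → Γ(X, V)) :
      ∑ l, a l • σ V l = 0 ↔ ∑ l, a l * r V l = 0 := by
    let E : Γ(M, V) →ₗ[Γ(X, V)] Γ(X, V) := (e.hom.val.app (.op V)).hom
    have hE : Function.Injective E := by
      have : IsIso (e.hom.app V) :=
        Modules.Hom.isIso_iff_isIso_app.mp e.isIso_hom V
      exact (ConcreteCategory.bijective_of_isIso (e.hom.app V)).1
    rw [← map_eq_zero_iff E hE, map_sum]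
    exact Eq.congr (Finset.sum_congr rfl fun l _ => _root_.map_smul E (a l) (σ V l)) rfl
  refine SheafOfModules.isFiniteType_kernel_freeHomEquiv_symm (R := X.ringCatSheaf) (M := M) s _
    X.coversTop_affineOpens fun V => ?_
  obtain ⟨n, c, hc⟩ := Submodule.fg_iff_exists_fin_generating_family.mp ((hX V).ker_fg (r V))
  refine ⟨n, c, fun j => (hs V (c j)).mpr ?_, fun U f a ha => ?_⟩
  · have h1 : c j ∈ LinearMap.ker (Fintype.linearCombination Γ(X, V) (r V)) :=
      hc ▸ Submodule.subset_span ⟨j, rfl⟩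
    exact h1
  replace ha := (hs U a).mp ha
  -- The sieve of opens lying in a basic open of `V` contained in `U`: there `a` is a relation over
  -- a localisation of `Γ(X, V)`.
  refine ⟨⟨fun W _ => ∃ g : Γ(X, V), W ≤ X.basicOpen g ∧ X.basicOpen g ≤ U,
    fun {_ _} _ ⟨g, h1, h2⟩ i => ⟨g, i.le.trans h1, h2⟩⟩, ?_, ?_⟩
  · intro x hx
    obtain ⟨g, h1, h2⟩ := V.2.exists_basicOpen_le ⟨x, hx⟩ (f.le hx)
    exact ⟨X.basicOpen g, homOfLE h1, ⟨g, le_rfl, h1⟩, h2⟩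
  · rintro W i ⟨g, hW, hU⟩
    have := V.2.isLocalization_basicOpen g
    obtain ⟨d, hd⟩ := IsLocalization.exists_eq_sum_smul_of_span_eq_ker
      (B := Γ(X, X.basicOpen g)) (.powers g) (r V) c hc
      (fun l => X.presheaf.map (homOfLE hU).op (a l)) (by
        have h1 := congrArg (X.presheaf.map (homOfLE hU).op).hom ha
        rw [map_sum, map_zero] at h1
        rw [← h1]
        refine Finset.sum_congr rfl fun l _ => ?_
        refine Eq.trans ?_ (map_mul (X.presheaf.map (homOfLE hU).op).hom (a l) (r U l)).symm
        exact congrArg _ ((hr (homOfLE (X.basicOpen_le g)) l).trans (hr (homOfLE hU) l).symm))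
    refine ⟨fun j => X.presheaf.map (homOfLE hW).op (d j), ?_⟩
    ext l
    have h1 := congrArg (X.presheaf.map (homOfLE hW).op).hom (congrFun hd l)
    rw [Finset.sum_apply, map_sum] at h1
    have h2 {T U' : X.Opens} (i : W ⟶ T) (j : T ⟶ U') (k : W ⟶ U') (b : Γ(X, U')) :
        X.presheaf.map i.op (X.presheaf.map j.op b) = X.presheaf.map k.op b := by
      rw [← ConcreteCategory.comp_apply, ← Functor.map_comp, ← op_comp]
      rfl
    refine (h2 (homOfLE hW) (homOfLE hU) i (a l)).symm.trans (h1.trans ?_)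
    refine Eq.trans ?_ (Finset.sum_apply (M := fun _ => Γ(X, W)) l Finset.univ _).symm
    refine Finset.sum_congr rfl fun j _ => ?_
    refine (map_mul (X.presheaf.map (homOfLE hW).op).hom _ _).trans (congrArg _ ?_)
    exact h2 (homOfLE hW) (homOfLE (X.basicOpen_le g)) (i ≫ f) (c j l)

end AlgebraicGeometry.Scheme

theorem HasFGSyzygies.of_isAffineOpen {R : Type u} [CommRing R] (hR : IsPruferRing R)
    {X : Scheme.{u}} (f : X ⟶ Spec (CommRingCat.of R)) [LocallyOfFinitePresentation f]
    {V : X.Opens} (hV : IsAffineOpen V) : HasFGSyzygies Γ(X, V) := by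
  have h1 := f.finitePresentation_appLE (isAffineOpen_top _) hV le_top
  have h2 := h1.comp (RingHom.FinitePresentation.of_bijective
    (ConcreteCategory.bijective_of_isIso (Scheme.ΓSpecIso (CommRingCat.of R)).inv))
  algebraize [((f.appLE ⊤ V le_top).hom.comp (Scheme.ΓSpecIso (CommRingCat.of R)).inv.hom)]
  exact of_isPruferRing hR Γ(X, V)

namespace AlgebraicGeometry.Scheme

theorem isFiniteType_unit (X : Scheme.{u}) :
    SheafOfModules.IsFiniteType.{u} (SheafOfModules.unit X.ringCatSheaf) := by
  refine SheafOfModules.isFiniteType_of_locally_mem_span (SheafOfModules.unit X.ringCatSheaf)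
    (fun V : X.affineOpens => V.1) X.coversTop_affineOpens fun V =>
    ⟨1, fun _ => (1 : Γ(X, V)), fun U f m => ⟨⊤, GrothendieckTopology.top_mem _ _,
      fun W g _ => ?_⟩⟩
  let x : Γ(X, W) := X.presheaf.map g.op m
  have h1 : X.presheaf.map (g ≫ f).op (1 : Γ(X, V)) = 1 := map_one (X.presheaf.map (g ≫ f).op).hom
  have h2 : x = x • X.presheaf.map (g ≫ f).op (1 : Γ(X, V)) := by
    rw [h1, smul_eq_mul, mul_one]
  have h3 : (SheafOfModules.unit X.ringCatSheaf).val.presheaf.map g.op m =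
      (show X.ringCatSheaf.obj.obj (.op W) from x) •
        (show (SheafOfModules.unit X.ringCatSheaf).val.obj (.op W) from
          X.presheaf.map (g ≫ f).op (1 : Γ(X, V))) := h2
  rw [h3]
  exact Submodule.smul_mem _ _ (Submodule.subset_span ⟨0, rfl⟩)

theorem isLocallyCoherent_of_locallyOfFinitePresentation {R : Type u} [CommRing R]
    (hR : IsPruferRing R) {X : Scheme.{u}} (f : X ⟶ Spec (CommRingCat.of R))
    [LocallyOfFinitePresentation f] : X.IsLocallyCoherent where
  isFiniteType := isFiniteType_unit X
  isFiniteType_kernel U _ _ s := Modules.isFiniteType_kernel_of_iso_unit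
    (fun V => HasFGSyzygies.of_isAffineOpen hR (U.ι ≫ f) V.2) (Modules.restrictUnitIso U.ι) s

end AlgebraicGeometry.Scheme

theorem lemma2p12 (R : Type u) [CommRing R] (hR : IsPruferRing R) :
    (∀ (X : Scheme.{u}) (f : X ⟶ Spec (CommRingCat.of R)) [LocallyOfFinitePresentation f],
      X.IsLocallyCoherent) ∧
    (∀ (A : Type u) [CommRing A] [Algebra R A] [Algebra.FinitePresentation R A],
      IsCoherentRing A ∧ ∀ J : Ideal A, J.FG → Module.FinitePresentation A J) := by
  refine ⟨fun X f _ => Scheme.isLocallyCoherent_of_locallyOfFinitePresentation hR f,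
    fun A _ _ _ => ⟨⟨?_, inferInstance, inferInstance⟩, fun J hJ =>
      (HasFGSyzygies.of_isPruferRing hR A).finitePresentation_ideal hJ⟩⟩
  have : LocallyOfFinitePresentation (Spec.map (CommRingCat.ofHom (algebraMap R A))) := by
    rw [LocallyOfFinitePresentation.SpecMap_iff, CommRingCat.hom_ofHom,
      RingHom.finitePresentation_algebraMap]
    infer_instance
  exact Scheme.isLocallyCoherent_of_locallyOfFinitePresentation hR
    (Spec.map (CommRingCat.ofHom (algebraMap R A)))
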